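/- **Theorem 3.** For a group $G$ with a finite generating set $\mathcal G$, let $\Gamma$ be the Cayley graph of $G$ with respect to $\mathcal G\cup\mathcal G^{-1}$ (vertices $g\in G$, edges joining $g$ to $ga$ for $a\in\mathcal G\cup\mathcal G^{-1}$), made into a metric space with path metric $d$ by giving each edge length one. Write $\ell(p)=d(1,p)$ for $p\in\Gamma$ and $B(n)=\{p\in\Gamma : \ell(p)\le n\}$. The group $G$ is *almost convex with respect to* $\mathcal G$ if for every integer $m\ge 0$ there is a constant $K(m)$ such that for all $n\ge 0$ and all $g,g'\in G$ with $\ell(g)=\ell(g')=n$ and $d(g,g')\le m$, there is an edge path in $\Gamma$ from $g$ to $g'$ that lies inside $B(n)$ and has length at most $K(m)$. Let $$N=\langle x,y \mid [[x,y],x]=[[x,y],y]=1\rangle,$$ and, for an integer $e\ge 1$, $$N^e=\langle x,y,z \mid [x,z]=[y,z]=1,\ [x,y]=z^e\rangle .$$ Then $N$ is almost convex with respect to $\{x,y\}$, and for every integer $e\ge 1$ the group $N^e$ is almost convex with respect to $\{x,y,z\}$. -/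

import Mathlib

namespace Nil

section AlmostConvex

variable {G : Type*} [Group G]

/-- The Cayley graph of `G` with respect to `S`: distinct vertices `g`, `h` are joined by an edge
iff `h = g * s` with `s ∈ S` or `s⁻¹ ∈ S`. -/
abbrev cayley (S : Set G) : SimpleGraph G := SimpleGraph.mulCayley S

/-- The word metric on `G`. -/
noncomputable def wordDist (S : Set G) (g h : G) : ℕ := (cayley S).dist g h

/-- The word length of an element of `G`. -/
noncomputable def wordLength (S : Set G) (g : G) : ℕ := wordDist S 1 g

/-- The distance, in the Cayley graph as a metric graph with edges of length one, from the vertex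
`1` to the point at parameter `t ∈ [0, 1]` of the edge from `u` to `v`: a shortest path to that
point passes through `u` or through `v`. -/
noncomputable def edgePointLength (S : Set G) (u v : G) (t : ℝ) : ℝ :=
  min ((wordLength S u : ℝ) + t) ((wordLength S v : ℝ) + (1 - t))

/-- The edge path `p` lies inside the ball of radius `n` around `1` in the metric Cayley graph:
all its vertices and all the points of its edges do. -/
def LiesInBall (S : Set G) (n : ℕ) {g h : G} (p : (cayley S).Walk g h) : Prop :=
  (∀ v ∈ p.support, wordLength S v ≤ n) ∧
    ∀ d ∈ p.darts, ∀ t ∈ Set.Icc (0 : ℝ) 1, edgePointLength S d.fst d.snd t ≤ n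

/-- Almost convexity `(m)`: a single constant `K` serves for all `n`, `g` and `g'`. -/
def AlmostConvexAt (S : Set G) (m : ℕ) : Prop :=
  ∃ K : ℕ, ∀ (n : ℕ) (g g' : G), wordLength S g = n → wordLength S g' = n → wordDist S g g' ≤ m →
    ∃ p : (cayley S).Walk g g', LiesInBall S n p ∧ p.length ≤ K

/-- `S` is a finite generating set of `G`, and `G` is almost convex with respect to `S`. -/
structure AlmostConvex (S : Set G) : Prop where
  finite : S.Finite
  generates : Subgroup.closure S = ⊤
  almostConvexAt : ∀ m : ℕ, AlmostConvexAt S m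

end AlmostConvex

open scoped commutatorElement in
/-- The relators of `⟨x, y | [[x, y], x] = [[x, y], y] = 1⟩`. -/
def relsN : Set (FreeGroup (Fin 2)) :=
  let x : FreeGroup (Fin 2) := FreeGroup.of 0
  let y : FreeGroup (Fin 2) := FreeGroup.of 1
  {⁅⁅x, y⁆, x⁆, ⁅⁅x, y⁆, y⁆}

/-- The group `N = ⟨x, y | [[x, y], x] = [[x, y], y] = 1⟩`. -/
abbrev N : Type := PresentedGroup relsN

/-- The generating set `{x, y}` of `N`. -/
def gensN : Set N := {PresentedGroup.of 0, PresentedGroup.of 1}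

open scoped commutatorElement in
/-- The relators of `⟨x, y, z | [x, z] = [y, z] = 1, [x, y] = z ^ e⟩`. -/
def relsNe (e : ℕ) : Set (FreeGroup (Fin 3)) :=
  let x : FreeGroup (Fin 3) := FreeGroup.of 0
  let y : FreeGroup (Fin 3) := FreeGroup.of 1
  let z : FreeGroup (Fin 3) := FreeGroup.of 2
  {⁅x, z⁆, ⁅y, z⁆, ⁅x, y⁆ * (z ^ e)⁻¹}

/-- The group `N^e = ⟨x, y, z | [x, z] = [y, z] = 1, [x, y] = z ^ e⟩`. -/
abbrev Ne (e : ℕ) : Type := PresentedGroup (relsNe e)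

/-- The generating set `{x, y, z}` of `N^e`. -/
def gensNe (e : ℕ) : Set (Ne e) :=
  {PresentedGroup.of 0, PresentedGroup.of 1, PresentedGroup.of 2}

end Nil

/-!
`N` is the Heisenberg group. A word spelling `g` is a lattice path with prescribed end point
`(g.a, g.b)` and prescribed area, so by isoperimetry the ball of radius `n` has a closed form: `g`
lies in it iff some `p × q` box around the chord of `g` has short enough boundary and large enough
area.

Let `g`, `g'` be close together in the ball of radius `n`. If `r` steps in one common direction `s`
lead from both of them to points of length at most `n - r`, with `r` large compared to their
distance, then the end points are at distance at most `2 r`, since conjugation by `s ^ r` changes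
the area by an amount linear in `r` only; hence a shortest path between them stays inside the ball.
By symmetry `g` lies in the first quadrant and has non-negative area. If its box can be chosen much
wider than `g`, then `s = x` works. If not, a bounded detour takes `g` to the corner of the box, and
`s = y⁻¹` works from there. If `g` is too close to the end of an axis for either, every shortest
path from `g` to the identity is nearly straight, and the first `r` steps of any two such paths
serve as well.

In `N^e`, the elements `x` and `y` generate a copy of `N`, undistorted up to a constant factor.
Since `z ^ (25 * e) = [x ^ 5, y ^ 5]` is shorter in `x` and `y` than in `z`, every element of a ball
is the product of an element of this copy in the same ball and a bounded power of `z`, so almost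
convexity passes from `N` to `N^e`.
-/

open scoped Pointwise

namespace Nil

/-! ### Paths of bounded length -/

section Joined

variable {V : Type*} {Γ : SimpleGraph V} {k l : ℕ} {u v w : V}

/-- `u` and `v` are joined in the graph `Γ` by an edge path of length at most `k`. -/
def Joined (Γ : SimpleGraph V) (k : ℕ) (u v : V) : Prop := ∃ p : Γ.Walk u v, p.length ≤ k

namespace Joined

theorem refl (k : ℕ) (u : V) : Joined Γ k u u := ⟨.nil, Nat.zero_le k⟩

theorem of_adj (h : Γ.Adj u v) : Joined Γ 1 u v := ⟨h.toWalk, le_rfl⟩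

theorem symm : Joined Γ k u v → Joined Γ k v u
  | ⟨p, hp⟩ => ⟨p.reverse, by rwa [SimpleGraph.Walk.length_reverse]⟩

theorem trans : Joined Γ k u v → Joined Γ l v w → Joined Γ (k + l) u w
  | ⟨p, hp⟩, ⟨q, hq⟩ => ⟨p.append q, by rw [SimpleGraph.Walk.length_append]; exact add_le_add hp hq⟩

theorem mono (hkl : k ≤ l) : Joined Γ k u v → Joined Γ l u v
  | ⟨p, hp⟩ => ⟨p, hp.trans hkl⟩

theorem map {W : Type*} {Γ' : SimpleGraph W} (φ : Γ →g Γ') :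
    Joined Γ k u v → Joined Γ' k (φ u) (φ v)
  | ⟨p, hp⟩ => ⟨p.map φ, by rwa [SimpleGraph.Walk.length_map]⟩

theorem exists_add (h : Joined Γ (k + l) u v) : ∃ w, Joined Γ k u w ∧ Joined Γ l w v := by
  obtain ⟨p, hp⟩ := h
  exact ⟨p.getVert k, ⟨p.take k, by rw [SimpleGraph.Walk.take_length]; exact min_le_left _ _⟩,
    ⟨p.drop k, by rw [SimpleGraph.Walk.drop_length]; lia⟩⟩

end Joined

end Joined

/-! ### Word length and paths in balls -/

section WordLength

variable {G H : Type*} [Group G] [Group H] {S : Set G} {T : Set H} {g h u v : G} {k n n' : ℕ}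

theorem cayley_adj_mul_iff {s : G} : (cayley S).Adj g (g * s) ↔ s ≠ 1 ∧ s ∈ S ∪ S⁻¹ := by
  simp [SimpleGraph.mulCayley_adj]

theorem cayley_adj_mul_left (g : G) : (cayley S).Adj (g * u) (g * v) ↔ (cayley S).Adj u v := by
  simp [SimpleGraph.mulCayley_adj, mul_assoc]

theorem joined_cayley_mul_left (g : G) (h : Joined (cayley S) k u v) :
    Joined (cayley S) k (g * u) (g * v) :=
  h.map ⟨(g * ·), (cayley_adj_mul_left g).2⟩

theorem joined_cayley_of_mem {s : G} (hs : s ∈ S ∪ S⁻¹) : Joined (cayley S) 1 1 s := by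
  by_cases h1 : s = 1
  · rw [h1]
    exact .refl 1 1
  · exact .of_adj (by simpa using cayley_adj_mul_iff (g := 1).2 ⟨h1, hs⟩)

theorem exists_joined_cayley (hS : Subgroup.closure S = ⊤) (g : G) :
    ∃ k, Joined (cayley S) k 1 g := by
  have hg : g ∈ Subgroup.closure S := hS ▸ Subgroup.mem_top g
  induction hg using Subgroup.closure_induction with
  | mem s hs => exact ⟨1, joined_cayley_of_mem (.inl hs)⟩
  | one => exact ⟨0, .refl 0 1⟩
  | mul u v _ _ hu hv =>
    obtain ⟨⟨k, hk⟩, ⟨l, hl⟩⟩ := hu, hv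
    exact ⟨k + l, hk.trans (by simpa using joined_cayley_mul_left u hl)⟩
  | inv u _ hu =>
    obtain ⟨k, hk⟩ := hu
    exact ⟨k, by simpa using (joined_cayley_mul_left u⁻¹ hk).symm⟩

theorem cayley_connected (hS : Subgroup.closure S = ⊤) : (cayley S).Connected where
  preconnected u v := by
    obtain ⟨k, p, -⟩ := exists_joined_cayley hS (u⁻¹ * v)
    obtain ⟨q, -⟩ := joined_cayley_mul_left u ⟨p, le_rfl⟩
    simpa using q.reachable
  nonempty := ⟨1⟩

theorem wordDist_le_iff (hS : Subgroup.closure S = ⊤) :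
    wordDist S g h ≤ k ↔ Joined (cayley S) k g h := by
  refine ⟨fun hk => ?_, fun ⟨p, hp⟩ => (SimpleGraph.dist_le p).trans hp⟩
  obtain ⟨p, hp⟩ := (cayley_connected hS).exists_walk_length_eq_dist g h
  exact ⟨p, hp.le.trans hk⟩

theorem wordLength_le_iff (hS : Subgroup.closure S = ⊤) :
    wordLength S g ≤ k ↔ Joined (cayley S) k 1 g :=
  wordDist_le_iff hS

theorem wordDist_eq_wordLength (hS : Subgroup.closure S = ⊤) (g h : G) :
    wordDist S g h = wordLength S (g⁻¹ * h) := by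
  refine eq_of_forall_ge_iff fun k => ?_
  rw [wordDist_le_iff hS, wordLength_le_iff hS]
  exact ⟨fun p => by simpa using joined_cayley_mul_left g⁻¹ p,
    fun p => by simpa using joined_cayley_mul_left g p⟩

theorem wordDist_comm (S : Set G) (g h : G) : wordDist S g h = wordDist S h g :=
  SimpleGraph.dist_comm

theorem wordLength_one (S : Set G) : wordLength S 1 = 0 := SimpleGraph.dist_self

theorem wordLength_le_one (hS : Subgroup.closure S = ⊤) {s : G} (hs : s ∈ S ∪ S⁻¹) :
    wordLength S s ≤ 1 :=
  (wordLength_le_iff hS).2 (joined_cayley_of_mem hs)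

theorem wordLength_le_add (hS : Subgroup.closure S = ⊤) (g h : G) :
    wordLength S h ≤ wordLength S g + wordDist S g h :=
  (cayley_connected hS).dist_triangle

theorem wordLength_mul_le (hS : Subgroup.closure S = ⊤) (g h : G) :
    wordLength S (g * h) ≤ wordLength S g + wordLength S h := by
  simpa [wordDist_eq_wordLength hS] using wordLength_le_add hS g (g * h)

theorem wordLength_inv (hS : Subgroup.closure S = ⊤) (g : G) :
    wordLength S g⁻¹ = wordLength S g := by
  simpa [wordDist_eq_wordLength hS] using wordDist_comm S g 1

theorem wordLength_pow_le (hS : Subgroup.closure S = ⊤) (g : G) (k : ℕ) :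
    wordLength S (g ^ k) ≤ k * wordLength S g := by
  induction k with
  | zero => simp [wordLength_one]
  | succ k ih =>
    rw [pow_succ, Nat.succ_mul]
    exact (wordLength_mul_le hS _ _).trans (add_le_add_left ih _)

theorem wordLength_pow_le_of_mem (hS : Subgroup.closure S = ⊤) {s : G} (hs : s ∈ S ∪ S⁻¹) (k : ℕ) :
    wordLength S (s ^ k) ≤ k :=
  (wordLength_pow_le hS s k).trans (by nlinarith [wordLength_le_one hS hs])

theorem wordLength_zpow_le (hS : Subgroup.closure S = ⊤) (g : G) (k : ℤ) :
    wordLength S (g ^ k) ≤ k.natAbs * wordLength S g := by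
  obtain ⟨m, rfl | rfl⟩ := k.eq_nat_or_neg
  · simpa using wordLength_pow_le hS g m
  · simpa [wordLength_inv hS] using wordLength_pow_le hS g m

theorem wordLength_induction (hS : Subgroup.closure S = ⊤) {P : ℕ → G → Prop}
    (one : ∀ k, P k 1) (mul : ∀ k g, ∀ s ∈ S ∪ S⁻¹, P k g → P (k + 1) (g * s))
    (hg : wordLength S g ≤ k) : P k g := by
  have along {u v : G} (p : (cayley S).Walk u v) : ∀ i, P i u → P (i + p.length) v := by
    induction p with
    | nil => exact fun i hi => hi
    | @cons u v w huv p ih =>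
      intro i hi
      rw [← mul_inv_cancel_left u v, cayley_adj_mul_iff] at huv
      have hv := mul i u _ huv.2 hi
      rw [mul_inv_cancel_left] at hv
      simpa [add_assoc, add_comm, add_left_comm] using ih (i + 1) hv
  obtain ⟨p, hp⟩ := (wordLength_le_iff hS).1 hg
  simpa [Nat.sub_add_cancel hp] using along p (k - p.length) (one _)

theorem wordLength_map_le (hS : Subgroup.closure S = ⊤) (hT : Subgroup.closure T = ⊤)
    (f : G →* H) (hf : ∀ s ∈ S, f s ∈ T) (g : G) : wordLength T (f g) ≤ wordLength S g := by
  refine wordLength_induction hS (P := fun k g => wordLength T (f g) ≤ k)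
    (fun k => by simp [wordLength_one]) (fun k g s hs ih => ?_) le_rfl
  have hfs : wordLength T (f s) ≤ 1 :=
    wordLength_le_one hT (hs.imp (hf s) fun h => by simpa using hf _ h)
  rw [map_mul]
  exact (wordLength_mul_le hT _ _).trans (add_le_add ih hfs)

/-- The edges of the Cayley graph that lie inside the ball of radius `n` around `1`. An edge between
two vertices at distance exactly `n` does not: its midpoint has distance `n + 1/2`. -/
def ballGraph (S : Set G) (n : ℕ) : SimpleGraph G where
  Adj u v := (cayley S).Adj u v ∧ (wordLength S u < n ∨ wordLength S v < n)
  symm := ⟨fun _ _ h => ⟨h.1.symm, h.2.symm⟩⟩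
  loopless := ⟨fun _ h => h.1.ne rfl⟩

theorem ballGraph_le (S : Set G) (n : ℕ) : ballGraph S n ≤ cayley S := fun _ _ h => And.left h

theorem Joined.of_ballGraph (h : Joined (ballGraph S n) k u v) : Joined (cayley S) k u v :=
  h.map (.ofLE (ballGraph_le S n))

theorem Joined.ballGraph_mono (h : Joined (ballGraph S n) k u v) (hn : n ≤ n') :
    Joined (ballGraph S n') k u v :=
  h.map (.ofLE (fun _ _ huv => ⟨huv.1, huv.2.imp (·.trans_le hn) (·.trans_le hn)⟩ :
    ballGraph S n ≤ ballGraph S n'))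

theorem wordDist_eq_one_iff : wordDist S u v = 1 ↔ (cayley S).Adj u v :=
  SimpleGraph.dist_eq_one_iff_adj

theorem wordLength_le_of_ballGraph_adj (hS : Subgroup.closure S = ⊤)
    (h : (ballGraph S n).Adj u v) : wordLength S v ≤ n := by
  have := wordLength_le_add hS u v
  rw [wordDist_eq_one_iff.2 h.1] at this
  obtain h | h := h.2 <;> lia

theorem edgePointLength_le_of_ballGraph_adj (h : (ballGraph S n).Adj u v) {t : ℝ}
    (ht : t ∈ Set.Icc (0 : ℝ) 1) : edgePointLength S u v t ≤ n := by
  have cast_le {w : G} (hw : wordLength S w < n) : (wordLength S w : ℝ) + 1 ≤ n := by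
    exact_mod_cast hw
  obtain hu | hv := h.2
  · exact (min_le_left _ _).trans (by linarith [cast_le hu, ht.2])
  · exact (min_le_right _ _).trans (by linarith [cast_le hv, ht.1])

theorem Joined.exists_walk_liesInBall (hS : Subgroup.closure S = ⊤) (hg : wordLength S g ≤ n)
    (hj : Joined (ballGraph S n) k g h) :
    ∃ p : (cayley S).Walk g h, LiesInBall S n p ∧ p.length ≤ k := by
  obtain ⟨p, hp⟩ := hj
  refine ⟨p.mapLe (ballGraph_le S n), ⟨?_, ?_⟩, by simpa using hp⟩
  · clear hp
    induction p with
    | nil => simpa using hg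
    | cons huv p ih =>
      simpa using ⟨hg, by simpa using ih (wordLength_le_of_ballGraph_adj hS huv)⟩
  · intro d hd t ht
    rw [SimpleGraph.Walk.darts_map, List.mem_map] at hd
    obtain ⟨d, -, rfl⟩ := hd
    exact edgePointLength_le_of_ballGraph_adj d.adj ht

theorem joined_ballGraph_of_walk (hS : Subgroup.closure S = ⊤) (p : (cayley S).Walk g h)
    (hp : wordLength S g + p.length ≤ n) : Joined (ballGraph S n) p.length g h := by
  induction p with
  | nil => exact .refl 0 _
  | @cons u v w huv p ih =>
    rw [SimpleGraph.Walk.length_cons] at hp ⊢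
    have hv := wordLength_le_add hS u v
    rw [wordDist_eq_one_iff.2 huv] at hv
    exact ((Joined.of_adj (And.intro huv (.inl (by lia)))).trans (ih (by lia))).mono (by lia)

theorem joined_ballGraph_of_wordDist_le (hS : Subgroup.closure S = ⊤) (hd : wordDist S g h ≤ k)
    (hg : wordLength S g + k ≤ n) : Joined (ballGraph S n) k g h := by
  obtain ⟨p, hp⟩ := (wordDist_le_iff hS).1 hd
  exact (joined_ballGraph_of_walk hS p (by lia)).mono hp

theorem joined_ballGraph_of_depth (hS : Subgroup.closure S = ⊤) (hd : wordDist S g h ≤ k + k)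
    (hg : wordLength S g + k ≤ n) (hh : wordLength S h + k ≤ n) :
    Joined (ballGraph S n) (k + k) g h := by
  obtain ⟨w, hgw, hwh⟩ := ((wordDist_le_iff hS).1 hd).exists_add
  exact (joined_ballGraph_of_wordDist_le hS ((wordDist_le_iff hS).2 hgw) hg).trans
    (joined_ballGraph_of_wordDist_le hS ((wordDist_le_iff hS).2 hwh.symm) hh).symm

theorem joined_ballGraph_via_one (hS : Subgroup.closure S = ⊤) (hg : wordLength S g ≤ n)
    (hh : wordLength S h ≤ n) : Joined (ballGraph S n) (n + n) g h := by
  have from_one {g : G} (hg : wordLength S g ≤ n) : Joined (ballGraph S n) n 1 g :=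
    joined_ballGraph_of_wordDist_le hS hg (by simp [wordLength_one])
  exact (from_one hg).symm.trans (from_one hh)

theorem Joined.map_ballGraph (hS : Subgroup.closure S = ⊤) (hT : Subgroup.closure T = ⊤)
    {f : G →* H} (hf : Function.Injective f) (hlen : ∀ g, wordLength T (f g) ≤ wordLength S g)
    (h : Joined (ballGraph S n) k u v) : Joined (ballGraph T n) k (f u) (f v) := by
  have adj {u v : G} (huv : (ballGraph S n).Adj u v) : (ballGraph T n).Adj (f u) (f v) := by
    refine ⟨?_, huv.2.imp (hlen u).trans_lt (hlen v).trans_lt⟩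
    have hle : wordDist T (f u) (f v) ≤ 1 := by
      rw [← wordDist_eq_one_iff.2 huv.1, wordDist_eq_wordLength hS, wordDist_eq_wordLength hT,
        ← map_inv, ← map_mul]
      exact hlen _
    have hne : wordDist T (f u) (f v) ≠ 0 :=
      mt (cayley_connected hT).dist_eq_zero_iff.1 (hf.ne huv.1.ne)
    exact wordDist_eq_one_iff.1 (by lia)
  exact h.map ⟨f, adj⟩

/-- Almost convexity in the form in which it is proved: any two points of a ball at distance at most
`m`, not only those on its boundary sphere, are joined inside it by a path of bounded length. -/
def BallConvex (S : Set G) : Prop :=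
  ∀ m : ℕ, ∃ K : ℕ, ∀ (n : ℕ) (g h : G), wordLength S g ≤ n → wordLength S h ≤ n →
    wordDist S g h ≤ m → Joined (ballGraph S n) K g h

theorem BallConvex.almostConvexAt (hS : Subgroup.closure S = ⊤) (hc : BallConvex S) (m : ℕ) :
    AlmostConvexAt S m := by
  obtain ⟨K, hK⟩ := hc m
  exact ⟨K, fun n g h hg hh hd => (hK n g h hg.le hh.le hd).exists_walk_liesInBall hS hg.le⟩

theorem BallConvex.of_mulEquiv (hS : Subgroup.closure S = ⊤) (hT : Subgroup.closure T = ⊤)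
    (f : G ≃* H) (hf : ∀ s ∈ S, f s ∈ T) (hf' : ∀ t ∈ T, f.symm t ∈ S) (hc : BallConvex T) :
    BallConvex S := by
  have hlen (g : G) : wordLength T (f g) ≤ wordLength S g :=
    wordLength_map_le hS hT f.toMonoidHom hf g
  have hlen' (h : H) : wordLength S (f.symm h) ≤ wordLength T h :=
    wordLength_map_le hT hS f.symm.toMonoidHom hf' h
  intro m
  obtain ⟨K, hK⟩ := hc m
  refine ⟨K, fun n g h hg hh hd => ?_⟩
  rw [wordDist_eq_wordLength hS] at hd
  have hd' : wordDist T (f g) (f h) ≤ m := by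
    rw [wordDist_eq_wordLength hT, ← map_inv, ← map_mul]
    exact (hlen _).trans hd
  simpa using (hK n (f g) (f h) ((hlen g).trans hg) ((hlen h).trans hh) hd').map_ballGraph hT hS
    (f := f.symm.toMonoidHom) f.symm.injective hlen'

end WordLength

/-! ### Heisenberg groups -/

/-- The Heisenberg group of integer triples with the law
`(a, b, c) (a', b', c') = (a + a', b + b', c + c' + e a b')`, the concrete model of `N^e`; the group
`N` is modelled by `Heis 1`. -/
@[ext]
structure Heis (e : ℤ) where
  a : ℤ
  b : ℤ
  c : ℤ

namespace Heis

section Group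

variable {e : ℤ}

instance : Mul (Heis e) := ⟨fun g h => ⟨g.a + h.a, g.b + h.b, g.c + h.c + e * (g.a * h.b)⟩⟩
instance : One (Heis e) := ⟨⟨0, 0, 0⟩⟩
instance : Inv (Heis e) := ⟨fun g => ⟨-g.a, -g.b, -g.c + e * (g.a * g.b)⟩⟩

@[simp] theorem mul_a (g h : Heis e) : (g * h).a = g.a + h.a := rfl
@[simp] theorem mul_b (g h : Heis e) : (g * h).b = g.b + h.b := rfl
@[simp] theorem mul_c (g h : Heis e) : (g * h).c = g.c + h.c + e * (g.a * h.b) := rfl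
@[simp] theorem one_a : (1 : Heis e).a = 0 := rfl
@[simp] theorem one_b : (1 : Heis e).b = 0 := rfl
@[simp] theorem one_c : (1 : Heis e).c = 0 := rfl
@[simp] theorem inv_a (g : Heis e) : g⁻¹.a = -g.a := rfl
@[simp] theorem inv_b (g : Heis e) : g⁻¹.b = -g.b := rfl
@[simp] theorem inv_c (g : Heis e) : g⁻¹.c = -g.c + e * (g.a * g.b) := rfl

instance : Group (Heis e) := Group.ofLeftAxioms
  (fun g h k => by ext <;> simp <;> ring)
  (fun g => by ext <;> simp)
  (fun g => by ext <;> simp)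

/-- The first standard generator of `Heis e`. -/
def x : Heis e := ⟨1, 0, 0⟩

/-- The second standard generator of `Heis e`. -/
def y : Heis e := ⟨0, 1, 0⟩

/-- The central generator of `Heis e`. -/
def z : Heis e := ⟨0, 0, 1⟩

theorem x_zpow (k : ℤ) : (x : Heis e) ^ k = ⟨k, 0, 0⟩ := by
  induction k with
  | zero => rfl
  | succ k ih => rw [zpow_add_one, ih]; ext <;> simp [x]
  | pred k ih => rw [zpow_sub_one, ih]; ext <;> simp [x, sub_eq_add_neg]

theorem y_zpow (k : ℤ) : (y : Heis e) ^ k = ⟨0, k, 0⟩ := by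
  induction k with
  | zero => rfl
  | succ k ih => rw [zpow_add_one, ih]; ext <;> simp [y]
  | pred k ih => rw [zpow_sub_one, ih]; ext <;> simp [y, sub_eq_add_neg]

theorem z_zpow (k : ℤ) : (z : Heis e) ^ k = ⟨0, 0, k⟩ := by
  induction k with
  | zero => rfl
  | succ k ih => rw [zpow_add_one, ih]; ext <;> simp [z]
  | pred k ih => rw [zpow_sub_one, ih]; ext <;> simp [z, sub_eq_add_neg]

theorem commute_z (g : Heis e) : Commute z g := by
  ext <;> simp [z, add_comm]

open scoped commutatorElement in
theorem commutator_x_y : ⁅(x : Heis e), (y : Heis e)⁆ = z ^ e := by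
  rw [z_zpow, commutatorElement_def]
  ext <;> simp [x, y]

theorem eq_zpow_mul (g : Heis e) : g = y ^ g.b * x ^ g.a * z ^ g.c := by
  ext <;> simp [x_zpow, y_zpow, z_zpow]

theorem monoidHom_ext {G : Type*} [Group G] {f f' : Heis e →* G} (hx : f x = f' x)
    (hy : f y = f' y) (hz : f z = f' z) : f = f' := by
  ext g
  rw [eq_zpow_mul g]
  simp only [map_mul, map_zpow, hx, hy, hz]

open scoped commutatorElement in
theorem zpow_mul_zpow_of_commutator_eq {G : Type*} [Group G] {x y w : G} (hx : Commute w x)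
    (hy : Commute w y) (hxy : ⁅x, y⁆ = w) (i j : ℤ) :
    x ^ i * y ^ j = w ^ (i * j) * y ^ j * x ^ i := by
  have hconj : y * x * y⁻¹ = w⁻¹ * x := by
    rw [← hxy, commutatorElement_def]
    group
  have hconj' : x ^ i * y * (x ^ i)⁻¹ = w ^ i * y := by
    have h : y * x ^ i * y⁻¹ = w ^ (-i) * x ^ i := by
      rw [← conj_zpow, hconj, hx.inv_left.mul_zpow, inv_zpow']
    rw [mul_inv_eq_iff_eq_mul, mul_assoc, ← inv_mul_eq_iff_eq_mul, ← zpow_neg, ← mul_assoc]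
    rw [mul_inv_eq_iff_eq_mul] at h
    rw [← h]
  rw [← mul_inv_eq_iff_eq_mul, ← conj_zpow, hconj', (hy.zpow_left i).mul_zpow, zpow_mul]

open scoped commutatorElement in
/-- The universal property of `Heis e` as the group presented like `N^e`. -/
def lift {G : Type*} [Group G] {x y z : G} (hx : Commute z x) (hy : Commute z y)
    (hxy : ⁅x, y⁆ = z ^ e) : Heis e →* G :=
  MonoidHom.mk' (fun g => y ^ g.b * x ^ g.a * z ^ g.c) fun g h => by
    have hzx (k l : ℤ) := hx.zpow_zpow k l
    have hzy (k l : ℤ) := hy.zpow_zpow k l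
    have hswap := zpow_mul_zpow_of_commutator_eq (hx.zpow_left e) (hy.zpow_left e) hxy g.a h.b
    calc y ^ (g * h).b * x ^ (g * h).a * z ^ (g * h).c
        = y ^ g.b * (y ^ h.b * x ^ g.a * (x ^ h.a * z ^ (e * (g.a * h.b)))) * z ^ (g.c + h.c) := by
          simp only [mul_a, mul_b, mul_c, add_comm _ (e * _), zpow_add, mul_assoc]
      _ = y ^ g.b * (x ^ g.a * y ^ h.b) * (x ^ h.a * z ^ (g.c + h.c)) := by
          rw [hswap, ← zpow_mul, ← (hzx _ _).eq, ← mul_assoc (y ^ h.b * x ^ g.a),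
            ← ((hzy _ _).mul_right (hzx _ _)).eq]
          simp only [mul_assoc]
      _ = y ^ g.b * x ^ g.a * z ^ g.c * (y ^ h.b * x ^ h.a * z ^ h.c) := by
          rw [zpow_add, ← mul_assoc (x ^ h.a), ← (hzx _ _).eq]
          simp only [mul_assoc]
          rw [← mul_assoc (y ^ h.b), ← (hzy _ _).eq]
          simp only [mul_assoc]

section Lift

variable {G : Type*} [Group G] {x' y' z' : G} (hx : Commute z' x') (hy : Commute z' y')

open scoped commutatorElement

@[simp] theorem lift_x (hxy : ⁅x', y'⁆ = z' ^ e) : lift hx hy hxy x = x' := by simp [lift, x]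
@[simp] theorem lift_y (hxy : ⁅x', y'⁆ = z' ^ e) : lift hx hy hxy y = y' := by simp [lift, y]
@[simp] theorem lift_z (hxy : ⁅x', y'⁆ = z' ^ e) : lift hx hy hxy z = z' := by simp [lift, z]

end Lift

theorem closure_x_y_z : Subgroup.closure {x, y, z} = (⊤ : Subgroup (Heis e)) := by
  rw [Subgroup.eq_top_iff']
  intro g
  rw [eq_zpow_mul g]
  refine mul_mem (mul_mem ?_ ?_) ?_ <;>
    exact zpow_mem (Subgroup.subset_closure (by simp)) _

theorem closure_x_y : Subgroup.closure {x, y} = (⊤ : Subgroup (Heis 1)) := by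
  have hx : x ∈ Subgroup.closure {x, (y : Heis 1)} := Subgroup.subset_closure (by simp)
  have hy : y ∈ Subgroup.closure {x, (y : Heis 1)} := Subgroup.subset_closure (by simp)
  have hz : z ∈ Subgroup.closure {x, (y : Heis 1)} := by
    rw [← zpow_one z, ← commutator_x_y, commutatorElement_def]
    exact mul_mem (mul_mem (mul_mem hx hy) (inv_mem hx)) (inv_mem hy)
  rw [Subgroup.eq_top_iff']
  intro g
  rw [eq_zpow_mul g]
  exact mul_mem (mul_mem (zpow_mem hy _) (zpow_mem hx _)) (zpow_mem hz _)

end Group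

end Heis

section Presentation

open Heis PresentedGroup
open scoped commutatorElement

theorem commute_commutator_of_zero : Commute ⁅(of 0 : N), (of 1 : N)⁆ (of 0) := by
  rw [← commutatorElement_eq_one_iff_commute]
  exact one_of_mem (rels := relsN) (.inl rfl)

theorem commute_commutator_of_one : Commute ⁅(of 0 : N), (of 1 : N)⁆ (of 1) := by
  rw [← commutatorElement_eq_one_iff_commute]
  exact one_of_mem (rels := relsN) (.inr rfl)

/-- The isomorphism of `N` with its model `Heis 1`. -/
def equivN : N ≃* Heis 1 :=
  MonoidHom.toMulEquiv
    (toGroup (f := ![x, y]) (by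
      rintro r (rfl | rfl) <;>
        simp [map_commutatorElement, commutator_x_y, commutatorElement_eq_one_iff_commute,
          commute_z]))
    (lift commute_commutator_of_zero commute_commutator_of_one (zpow_one _).symm)
    (PresentedGroup.ext fun i => by fin_cases i <;> simp)
    (monoidHom_ext (by simp) (by simp)
      (by simpa [map_commutatorElement] using commutator_x_y (e := 1)))

variable (e : ℕ)

theorem commute_of_two_of_zero : Commute (of 2 : Ne e) (of 0) := by
  rw [← commutatorElement_eq_one_iff_commute, ← commutatorElement_inv, inv_eq_one]
  exact one_of_mem (rels := relsNe e) (.inl rfl)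

theorem commute_of_two_of_one : Commute (of 2 : Ne e) (of 1) := by
  rw [← commutatorElement_eq_one_iff_commute, ← commutatorElement_inv, inv_eq_one]
  exact one_of_mem (rels := relsNe e) (.inr (.inl rfl))

theorem commutator_of_zero_of_one : ⁅(of 0 : Ne e), (of 1 : Ne e)⁆ = (of 2) ^ (e : ℤ) := by
  rw [zpow_natCast]
  exact mk_eq_mk_of_mul_inv_mem (rels := relsNe e) (.inr (.inr rfl))

/-- The isomorphism of `N^e` with its model `Heis e`. -/
def equivNe : Ne e ≃* Heis e :=
  MonoidHom.toMulEquiv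
    (toGroup (f := ![x, y, z]) (by
      rintro r (rfl | rfl | rfl) <;>
        simp [map_commutatorElement, commutator_x_y, commutatorElement_eq_one_iff_commute,
          (commute_z _).symm]))
    (lift (commute_of_two_of_zero e) (commute_of_two_of_one e) (commutator_of_zero_of_one e))
    (PresentedGroup.ext fun i => by fin_cases i <;> simp)
    (monoidHom_ext (by simp) (by simp) (by simp))

theorem closure_gensN : Subgroup.closure gensN = ⊤ := by
  rw [← closure_range_of relsN]
  congr 1
  ext g
  simp [gensN, Fin.exists_fin_two, eq_comm]

theorem closure_gensNe : Subgroup.closure (gensNe e) = ⊤ := by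
  rw [← closure_range_of (relsNe e)]
  congr 1
  ext g
  simp [gensNe, Fin.exists_fin_succ, eq_comm]

theorem ballConvex_gensN (h : BallConvex {x, (y : Heis 1)}) : BallConvex gensN := by
  refine h.of_mulEquiv closure_gensN closure_x_y equivN ?_ ?_
  · rintro s (rfl | rfl) <;> simp [equivN]
  · rintro s (rfl | rfl) <;> simp [equivN, gensN]

theorem ballConvex_gensNe (h : BallConvex {x, y, (z : Heis e)}) : BallConvex (gensNe e) := by
  refine h.of_mulEquiv (closure_gensNe e) closure_x_y_z (equivNe e) ?_ ?_
  · rintro s (rfl | rfl | rfl) <;> simp [equivNe]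
  · rintro s (rfl | rfl | rfl) <;> simp [equivNe, gensNe]

end Presentation

/-! ### The ball of radius `n` in `Heis 1` -/

namespace Heis

/-- The standard generating set of `Heis 1`. -/
def gens : Set (Heis 1) := {x, y}

theorem closure_gens : Subgroup.closure gens = ⊤ := closure_x_y

theorem x_mem_gens : x ∈ gens := .inl rfl
theorem y_mem_gens : y ∈ gens := .inr rfl

/-- Twice the signed area between the projection of a path from `1` to `g` to the `(a, b)`-plane and
the chord joining its ends. It is used in place of `c` because the symmetries below act on it by
signs. -/
def area (g : Heis 1) : ℤ := 2 * g.c - g.a * g.b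

@[simp] theorem area_one : area 1 = 0 := rfl
@[simp] theorem area_inv (g : Heis 1) : area g⁻¹ = -area g := by simp [area]; ring
@[simp] theorem area_mul (g h : Heis 1) :
    area (g * h) = area g + area h + (g.a * h.b - h.a * g.b) := by simp [area]; ring

@[simp] theorem x_a : (x : Heis 1).a = 1 := rfl
@[simp] theorem x_b : (x : Heis 1).b = 0 := rfl
@[simp] theorem y_a : (y : Heis 1).a = 0 := rfl
@[simp] theorem y_b : (y : Heis 1).b = 1 := rfl
@[simp] theorem area_x : area x = 0 := rfl
@[simp] theorem area_y : area y = 0 := rfl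

@[simp] theorem pow_a (g : Heis 1) (r : ℕ) : (g ^ r).a = r * g.a := by
  induction r with
  | zero => simp
  | succ r ih => rw [pow_succ, mul_a, ih]; push_cast; ring

@[simp] theorem pow_b (g : Heis 1) (r : ℕ) : (g ^ r).b = r * g.b := by
  induction r with
  | zero => simp
  | succ r ih => rw [pow_succ, mul_b, ih]; push_cast; ring

@[simp] theorem area_pow (g : Heis 1) (r : ℕ) : area (g ^ r) = r * area g := by
  induction r with
  | zero => simp
  | succ r ih => rw [pow_succ, area_mul, ih, pow_a, pow_b]; push_cast; ring

theorem ext_area {g h : Heis 1} (ha : g.a = h.a) (hb : g.b = h.b) (ht : area g = area h) :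
    g = h := by
  ext
  · exact ha
  · exact hb
  · rw [area, area, ha, hb] at ht
    lia

/-- The ball of radius `n` in closed form: a shortest path to `g` runs along the boundary of a
`p × q` box, up to one cut corner. -/
def Ball (n : ℤ) (g : Heis 1) : Prop :=
  ∃ p q : ℤ, |g.a| ≤ p ∧ |g.b| ≤ q ∧ 2 * (p + q) ≤ n + |g.a| + |g.b| ∧
    |area g| + |g.a| * |g.b| ≤ 2 * p * q

section Ball

variable {n n' p q : ℤ} {g : Heis 1}

theorem ball_of_nonneg (ha : 0 ≤ g.a) (hb : 0 ≤ g.b) (hp : g.a ≤ p) (hq : g.b ≤ q)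
    (hn : 2 * (p + q) ≤ n + g.a + g.b) (ht : area g + g.a * g.b ≤ 2 * p * q)
    (ht' : -area g + g.a * g.b ≤ 2 * p * q) : Ball n g := by
  refine ⟨p, q, ?_⟩
  rw [abs_of_nonneg ha, abs_of_nonneg hb]
  exact ⟨hp, hq, hn, by cases abs_cases (area g) <;> lia⟩

theorem Ball.exists_of_nonneg (h : Ball n g) (ha : 0 ≤ g.a) (hb : 0 ≤ g.b) (ht : 0 ≤ area g) :
    ∃ p q, g.a ≤ p ∧ g.b ≤ q ∧ 2 * (p + q) ≤ n + g.a + g.b ∧ area g + g.a * g.b ≤ 2 * p * q := by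
  simpa only [Ball, abs_of_nonneg ha, abs_of_nonneg hb, abs_of_nonneg ht] using h

theorem Ball.mono (h : Ball n g) (hn : n ≤ n') : Ball n' g := by
  obtain ⟨p, q, h₁, h₂, h₃, h₄⟩ := h
  exact ⟨p, q, h₁, h₂, by linarith, h₄⟩

theorem Ball.abs_add_abs_le (h : Ball n g) : |g.a| + |g.b| ≤ n := by
  obtain ⟨p, q, h₁, h₂, h₃, -⟩ := h
  linarith

theorem Ball.nonneg (h : Ball n g) : 0 ≤ n := by
  linarith [h.abs_add_abs_le, abs_nonneg g.a, abs_nonneg g.b]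

theorem Ball.abs_area_le (h : Ball n g) : |area g| ≤ n ^ 2 := by
  have h0 := h.abs_add_abs_le
  obtain ⟨p, q, h₁, h₂, h₃, h₄⟩ := h
  have h5 := abs_nonneg g.a
  have h6 := abs_nonneg g.b
  have h7 : 0 ≤ |g.a| * |g.b| := by positivity
  nlinarith [sq_nonneg (p - q)]

theorem ball_one (hn : 0 ≤ n) : Ball n 1 := ⟨0, 0, by simp, by simp, by simpa, by simp⟩

end Ball

/-- Rotation by a quarter turn. -/
def rot : Heis 1 ≃* Heis 1 where
  toFun g := ⟨-g.b, g.a, g.c - g.a * g.b⟩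
  invFun g := ⟨g.b, -g.a, g.c - g.a * g.b⟩
  left_inv g := by ext <;> simp [mul_comm]
  right_inv g := by ext <;> simp [mul_comm]
  map_mul' g h := by ext <;> simp <;> ring

/-- Reflection in the diagonal. -/
def swap : Heis 1 ≃* Heis 1 where
  toFun g := ⟨g.b, g.a, g.a * g.b - g.c⟩
  invFun g := ⟨g.b, g.a, g.a * g.b - g.c⟩
  left_inv g := by ext <;> simp [mul_comm]
  right_inv g := by ext <;> simp [mul_comm]
  map_mul' g h := by
    ext <;> simp
    ring

@[simp] theorem rot_a (g : Heis 1) : (rot g).a = -g.b := rfl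
@[simp] theorem rot_b (g : Heis 1) : (rot g).b = g.a := rfl
@[simp] theorem area_rot (g : Heis 1) : area (rot g) = area g := by simp [area, rot]; ring
@[simp] theorem rot_symm_a (g : Heis 1) : (rot.symm g).a = g.b := rfl
@[simp] theorem rot_symm_b (g : Heis 1) : (rot.symm g).b = -g.a := rfl
@[simp] theorem area_rot_symm (g : Heis 1) : area (rot.symm g) = area g := by
  rw [← area_rot, rot.apply_symm_apply]
theorem rot_y_inv : rot y⁻¹ = x := rfl
theorem rot_symm_x : rot.symm x = y⁻¹ := rfl
theorem rot_symm_y : rot.symm y = x := rfl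
@[simp] theorem swap_a (g : Heis 1) : (swap g).a = g.b := rfl
@[simp] theorem swap_b (g : Heis 1) : (swap g).b = g.a := rfl
@[simp] theorem area_swap (g : Heis 1) : area (swap g) = -area g := by simp [area, swap]; ring

theorem mem_gens_union_inv {s : Heis 1} :
    s ∈ gens ∪ gens⁻¹ ↔ area s = 0 ∧ |s.a| + |s.b| = 1 := by
  constructor
  · rintro ((rfl | rfl) | h | h)
    · simp
    · simp
    all_goals
      obtain rfl := inv_eq_iff_eq_inv.1 h
      simp
  · rintro ⟨ht, hab⟩
    have axis : (s.a = 1 ∨ s.a = -1) ∧ s.b = 0 ∨ s.a = 0 ∧ (s.b = 1 ∨ s.b = -1) := by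
      cases abs_cases s.a <;> cases abs_cases s.b <;> lia
    rcases axis with ⟨ha | ha, hb⟩ | ⟨ha, hb | hb⟩
    · exact .inl (.inl (ext_area ha hb ht))
    · exact .inr (.inl (inv_eq_iff_eq_inv.2 (ext_area (by simpa) (by simpa) (by simpa))))
    · exact .inl (.inr (ext_area ha hb ht))
    · exact .inr (.inr (inv_eq_iff_eq_inv.2 (ext_area (by simpa) (by simpa) (by simpa))))

/-- An automorphism of `Heis 1` that permutes the generators and their inverses, and preserves the
closed form of the balls. -/
structure IsSymmetry (f : Heis 1 ≃* Heis 1) : Prop where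
  mem_gens_iff : ∀ s, f s ∈ gens ∪ gens⁻¹ ↔ s ∈ gens ∪ gens⁻¹
  ball_iff : ∀ n g, Ball n (f g) ↔ Ball n g

theorem isSymmetry_rot : IsSymmetry rot where
  mem_gens_iff s := by simp only [mem_gens_union_inv, area_rot, rot_a, rot_b, abs_neg, add_comm]
  ball_iff n g := by
    simp only [Ball, rot_a, rot_b, area_rot, abs_neg]
    constructor <;> rintro ⟨p, q, h₁, h₂, h₃, h₄⟩ <;>
      exact ⟨q, p, h₂, h₁, by linarith, by linarith⟩

theorem isSymmetry_swap : IsSymmetry swap where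
  mem_gens_iff s := by
    simp only [mem_gens_union_inv, area_swap, swap_a, swap_b, neg_eq_zero, add_comm]
  ball_iff n g := by
    simp only [Ball, swap_a, swap_b, area_swap, abs_neg]
    constructor <;> rintro ⟨p, q, h₁, h₂, h₃, h₄⟩ <;>
      exact ⟨q, p, h₂, h₁, by linarith, by linarith⟩

namespace IsSymmetry

variable {f f' : Heis 1 ≃* Heis 1}

theorem refl : IsSymmetry (.refl _) := ⟨fun _ => Iff.rfl, fun _ _ => Iff.rfl⟩

theorem symm (hf : IsSymmetry f) : IsSymmetry f.symm :=
  ⟨fun s => by rw [← hf.mem_gens_iff, f.apply_symm_apply],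
    fun n g => by rw [← hf.ball_iff, f.apply_symm_apply]⟩

theorem trans (hf : IsSymmetry f) (hf' : IsSymmetry f') : IsSymmetry (f.trans f') :=
  ⟨fun s => (hf'.mem_gens_iff _).trans (hf.mem_gens_iff s),
    fun n g => (hf'.ball_iff n _).trans (hf.ball_iff n g)⟩

end IsSymmetry

theorem exists_symmetry (g : Heis 1) :
    ∃ f, IsSymmetry f ∧ 0 ≤ (f g).a ∧ 0 ≤ (f g).b ∧ 0 ≤ area (f g) := by
  have quadrant : ∃ f, IsSymmetry f ∧ 0 ≤ (f g).a ∧ 0 ≤ (f g).b := by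
    have r := isSymmetry_rot
    rcases le_total 0 g.a with ha | ha <;> rcases le_total 0 g.b with hb | hb
    · exact ⟨_, .refl, ha, hb⟩
    · exact ⟨_, r, by simpa, by simpa⟩
    · exact ⟨_, (r.trans r).trans r, by simpa, by simpa⟩
    · exact ⟨_, r.trans r, by simpa, by simpa⟩
  obtain ⟨f, hf, ha, hb⟩ := quadrant
  rcases le_total 0 (area (f g)) with ht | ht
  · exact ⟨f, hf, ha, hb, ht⟩
  · exact ⟨f.trans swap, hf.trans isSymmetry_swap, by simpa, by simpa, by simpa⟩

theorem Ball.mul_x {n : ℤ} {g : Heis 1} (h : Ball n g) : Ball (n + 1) (g * x) := by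
  obtain ⟨p, q, h₁, h₂, h₃, h₄⟩ := h
  have ht : |area g - g.b| ≤ |area g| + |g.b| := abs_sub _ _
  rcases le_or_gt 0 g.a with ha | ha
  · have ha' : |g.a + 1| = |g.a| + 1 := by rw [abs_of_nonneg ha, abs_of_nonneg]; linarith
    refine ⟨p + 1, q, ?_, ?_, ?_, ?_⟩ <;>
      simp only [mul_a, mul_b, area_mul, x_a, x_b, area_x, ha', add_zero, mul_zero, one_mul,
        zero_sub, ← sub_eq_add_neg] <;> nlinarith
  · have ha' : |g.a + 1| = |g.a| - 1 := by
      rw [abs_of_neg ha, abs_of_nonpos (by lia)]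
      ring
    refine ⟨p, q, ?_, ?_, ?_, ?_⟩ <;>
      simp only [mul_a, mul_b, area_mul, x_a, x_b, area_x, ha', add_zero, mul_zero, one_mul,
        zero_sub, ← sub_eq_add_neg] <;> nlinarith

theorem exists_symmetry_of_mem {s : Heis 1} (hs : s ∈ gens ∪ gens⁻¹) :
    ∃ f, IsSymmetry f ∧ f s = x := by
  have r := isSymmetry_rot
  rcases hs with (rfl | rfl) | hs | hs
  · exact ⟨_, .refl, rfl⟩
  · exact ⟨_, isSymmetry_swap, rfl⟩
  · obtain rfl := inv_eq_iff_eq_inv.1 hs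
    exact ⟨_, r.trans r, rfl⟩
  · obtain rfl := inv_eq_iff_eq_inv.1 hs
    exact ⟨_, r, rfl⟩

theorem Ball.mul_gen {n : ℤ} {g s : Heis 1} (h : Ball n g) (hs : s ∈ gens ∪ gens⁻¹) :
    Ball (n + 1) (g * s) := by
  obtain ⟨f, hf, hfs⟩ := exists_symmetry_of_mem hs
  rw [← hf.ball_iff, map_mul, hfs]
  exact ((hf.ball_iff n g).2 h).mul_x

section Descent

variable {n p q : ℤ} {g : Heis 1}

theorem ball_mul_x_of_lt (ha : 0 ≤ g.a) (hb : 0 ≤ g.b) (ht : 0 ≤ area g) (hp : g.a < p)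
    (hq : g.b ≤ q) (hn : 2 * (p + q) ≤ n + g.a + g.b) (hpq : area g + g.a * g.b ≤ 2 * p * q) :
    Ball (n - 1) (g * x) := by
  refine ball_of_nonneg (p := p) (q := q) ?_ ?_ ?_ ?_ ?_ ?_ ?_ <;> simp <;> nlinarith

theorem exists_descent_of_pos (ha : 0 ≤ g.a) (hb : 0 < g.b) (ht : 0 ≤ area g) (hq : g.b ≤ q)
    (hn : 2 * (g.a + q) ≤ n + g.a + g.b) (hpq : area g + g.a * g.b ≤ 2 * g.a * q) :
    Ball (n - 1) (g * x⁻¹) ∨ Ball (n - 1) (g * y⁻¹) := by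
  -- Stepping down sweeps away the area `2 * g.a`, which a box of height one may not have to spare.
  by_cases h1 : q = 1 ∧ area g < g.a
  · obtain ⟨rfl, hta⟩ := h1
    have hb1 : g.b = 1 := by lia
    have hta' : area g + 2 ≤ g.a := by
      rw [area, hb1] at hta ⊢
      lia
    refine .inl (ball_of_nonneg (p := g.a - 1) (q := 1) ?_ ?_ ?_ ?_ ?_ ?_ ?_) <;>
      simp [hb1] <;> lia
  · have hyp : -area g + g.a * g.b ≤ 2 * g.a * (q - 1) := by
      rcases not_and_or.1 h1 with h | h
      · nlinarith [show 2 ≤ q by lia]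
      · nlinarith
    refine .inr (ball_of_nonneg (p := g.a) (q := q - 1) ?_ ?_ ?_ ?_ ?_ ?_ ?_) <;>
      simp <;> lia

theorem exists_descent_of_eq_zero (ha : 0 ≤ g.a) (hb : g.b = 0) (ht : 0 ≤ area g) (h1 : g ≠ 1)
    (hq : 0 ≤ q) (hn : 2 * (g.a + q) ≤ n + g.a) (hpq : area g ≤ 2 * g.a * q) :
    Ball (n - 1) (g * x⁻¹) ∨ Ball (n - 1) (g * y⁻¹) := by
  rcases hq.lt_or_eq with hq | rfl
  · refine .inr ⟨g.a, q, ?_, ?_, ?_, ?_⟩ <;> simp [hb, abs_of_nonneg ha] <;> try lia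
    cases abs_cases (area g + -g.a) <;> nlinarith
  · have ht0 : area g = 0 := by linarith
    have ha0 : g.a ≠ 0 := fun ha0 => h1 (ext_area ha0 hb ht0)
    refine .inl (ball_of_nonneg (p := g.a - 1) (q := 0) ?_ ?_ ?_ ?_ ?_ ?_ ?_) <;>
      simp [hb, ht0] <;> lia

theorem Ball.exists_descent (h : Ball n g) (h1 : g ≠ 1) :
    ∃ s ∈ gens ∪ gens⁻¹, Ball (n - 1) (g * s) := by
  have first_quadrant {g : Heis 1} (h : Ball n g) (h1 : g ≠ 1) (ha : 0 ≤ g.a) (hb : 0 ≤ g.b)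
      (ht : 0 ≤ area g) : ∃ s ∈ gens ∪ gens⁻¹, Ball (n - 1) (g * s) := by
    obtain ⟨p, q, hp, hq, hn, hpq⟩ := h.exists_of_nonneg ha hb ht
    rcases hp.lt_or_eq with hp | rfl
    · exact ⟨x, .inl x_mem_gens, ball_mul_x_of_lt ha hb ht hp hq hn hpq⟩
    · have hxy : Ball (n - 1) (g * x⁻¹) ∨ Ball (n - 1) (g * y⁻¹) := by
        rcases hb.lt_or_eq with hb | hb
        · exact exists_descent_of_pos ha hb ht hq hn hpq
        · exact exists_descent_of_eq_zero ha hb.symm ht h1 (hb.trans_le hq) (by lia)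
            (by simpa [← hb] using hpq)
      exact hxy.elim (fun h => ⟨x⁻¹, .inr (by simp [x_mem_gens]), h⟩)
        (fun h => ⟨y⁻¹, .inr (by simp [y_mem_gens]), h⟩)
  obtain ⟨f, hf, ha, hb, ht⟩ := exists_symmetry g
  obtain ⟨s, hs, hgs⟩ := first_quadrant ((hf.ball_iff n g).2 h) (by simpa using h1) ha hb ht
  refine ⟨f.symm s, (hf.symm.mem_gens_iff s).2 hs, ?_⟩
  rwa [← hf.ball_iff, map_mul, f.apply_symm_apply]

end Descent

theorem wordLength_le_iff_ball {n : ℤ} {g : Heis 1} : (wordLength gens g : ℤ) ≤ n ↔ Ball n g := by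
  constructor
  · intro h
    refine Ball.mono ?_ h
    exact wordLength_induction closure_gens (P := fun k g => Ball k g)
      (fun k => ball_one (by positivity)) (fun k g s hs ih => by simpa using ih.mul_gen hs) le_rfl
  · intro h
    lift n to ℕ using h.nonneg
    induction n generalizing g with
    | zero =>
      have hab := h.abs_add_abs_le
      have ht : area g = 0 := by simpa using h.abs_area_le
      have ha : g.a = 0 := by cases abs_cases g.a <;> cases abs_cases g.b <;> lia
      have hb : g.b = 0 := by cases abs_cases g.a <;> cases abs_cases g.b <;> lia
      simp [ext_area (h := 1) ha hb ht, wordLength_one]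
    | succ n ih =>
      by_cases h1 : g = 1
      · simpa [h1, wordLength_one] using n.cast_add_one_pos.le
      obtain ⟨s, hs, hgs⟩ := h.exists_descent h1
      have hlen := wordLength_mul_le closure_gens (g * s) s⁻¹
      rw [mul_inv_cancel_right, wordLength_inv closure_gens] at hlen
      have := ih (by simpa using hgs)
      have := wordLength_le_one closure_gens hs
      push_cast
      lia

theorem IsSymmetry.wordLength_eq {f : Heis 1 ≃* Heis 1} (hf : IsSymmetry f) (g : Heis 1) :
    wordLength gens (f g) = wordLength gens g := by
  zify
  exact eq_of_forall_ge_iff fun n => by simp only [wordLength_le_iff_ball, hf.ball_iff]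

/-! ### Almost convexity of `Heis 1` -/

section Descending

variable {n m k L r D : ℕ} {g g' s u u' : Heis 1}

theorem wordLength_le_of_ball (h : Ball n g) : wordLength gens g ≤ n := by
  exact_mod_cast wordLength_le_iff_ball.2 h

theorem ball_of_wordLength_le (h : wordLength gens g ≤ n) : Ball n g :=
  wordLength_le_iff_ball.1 (by exact_mod_cast h)

theorem wordLength_add_le_of_ball (h : Ball (n - r) g) : wordLength gens g + r ≤ n := by
  have := wordLength_le_iff_ball.2 h
  lia

theorem joined_mul_of_ball (hu : wordLength gens u ≤ r) (h : Ball (n - r) (g * u)) :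
    Joined (ballGraph gens n) r g (g * u) := by
  refine (joined_ballGraph_of_wordDist_le closure_gens ?_ (wordLength_add_le_of_ball h)).symm
  rwa [wordDist_comm, wordDist_eq_wordLength closure_gens, inv_mul_cancel_left]

theorem joined_of_ball_mul (hu : wordLength gens u ≤ r) (hu' : wordLength gens u' ≤ r)
    (hg : Ball (n - r) (g * u)) (hg' : Ball (n - r) (g' * u'))
    (hd : Ball (2 * r) (u⁻¹ * (g⁻¹ * g') * u')) :
    Joined (ballGraph gens n) (4 * r) g g' := by
  have hd : wordDist gens (g * u) (g' * u') ≤ r + r := by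
    rw [wordDist_eq_wordLength closure_gens]
    refine wordLength_le_of_ball ?_
    convert hd using 1
    · push_cast
      ring
    · group
  have descent := joined_ballGraph_of_depth closure_gens hd (wordLength_add_le_of_ball hg)
    (wordLength_add_le_of_ball hg')
  exact (((joined_mul_of_ball hu hg).trans descent).trans
    (joined_mul_of_ball hu' hg').symm).mono (by lia)

theorem ball_two_mul_of_abs_le (ha : |g.a| ≤ D) (hb : |g.b| ≤ D)
    (ht : |area g| ≤ D ^ 2 + 2 * r * D) (hr : 5 * D ≤ r) : Ball (2 * r) g := by
  refine ⟨2 * D, r - 2 * D, by lia, by lia, by linarith [abs_nonneg g.a, abs_nonneg g.b], ?_⟩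
  have : |g.a| * |g.b| ≤ D * D := mul_le_mul ha hb (abs_nonneg _) (by positivity)
  have : (D : ℤ) * (5 * D) ≤ D * r := mul_le_mul_of_nonneg_left (by lia) (by positivity)
  nlinarith

theorem ball_conj_pow (hs : s ∈ gens ∪ gens⁻¹) (hu : wordLength gens u ≤ D) (hr : 5 * D ≤ r) :
    Ball (2 * r) ((s ^ r)⁻¹ * u * s ^ r) := by
  obtain ⟨-, hs⟩ := mem_gens_union_inv.1 hs
  have hu := ball_of_wordLength_le hu
  have hab := hu.abs_add_abs_le
  have ha := abs_nonneg u.a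
  have hb := abs_nonneg u.b
  refine ball_two_mul_of_abs_le (D := D) ?_ ?_ ?_ hr
  · simp; linarith
  · simp; linarith
  · have hcross : |u.a * s.b - s.a * u.b| ≤ D := by
      refine (abs_sub _ _).trans ?_
      rw [abs_mul, abs_mul]
      nlinarith [abs_nonneg s.a, abs_nonneg s.b]
    have harea : area ((s ^ r)⁻¹ * u * s ^ r) = area u + 2 * r * (u.a * s.b - s.a * u.b) := by
      simp
      ring
    rw [harea]
    refine (abs_add_le _ _).trans (add_le_add hu.abs_area_le ?_)
    rw [abs_mul, abs_of_nonneg (by positivity)]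
    exact mul_le_mul_of_nonneg_left hcross (by positivity)

/-- A path of length at most `L` in the ball of radius `n` leads from `g` to a point from which `r`
steps in the direction `s` approach the identity. -/
def Descends (n L r : ℕ) (s g : Heis 1) : Prop :=
  ∃ h, Joined (ballGraph gens n) L g h ∧ Ball (n - r) (h * s ^ r)

theorem Descends.of_ball (h : Ball (n - r) (g * s ^ r)) : Descends n 0 r s g :=
  ⟨g, .refl 0 g, h⟩

theorem Descends.mono (h : Descends n k r s g) (hkL : k ≤ L) : Descends n L r s g := by
  obtain ⟨g', h, hg'⟩ := h
  exact ⟨g', h.mono hkL, hg'⟩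

theorem Descends.of_joined (h : Joined (ballGraph gens n) k g g') (hg' : Descends n L r s g') :
    Descends n (k + L) r s g := by
  obtain ⟨h', hj, hh'⟩ := hg'
  exact ⟨h', h.trans hj, hh'⟩

theorem Descends.joined (hs : s ∈ gens ∪ gens⁻¹) (hr : 5 * (2 * L + m) ≤ r)
    (hd : wordDist gens g g' ≤ m) (hg : Descends n L r s g) (hg' : Descends n L r s g') :
    Joined (ballGraph gens n) (2 * L + 4 * r) g g' := by
  obtain ⟨h, hj, hh⟩ := hg
  obtain ⟨h', hj', hh'⟩ := hg'
  have hpow : wordLength gens (s ^ r) ≤ r := wordLength_pow_le_of_mem closure_gens hs r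
  have hhh : wordLength gens (h⁻¹ * h') ≤ 2 * L + m := by
    rw [← wordDist_eq_wordLength closure_gens, wordDist_le_iff closure_gens]
    exact ((hj.symm.of_ballGraph.trans ((wordDist_le_iff closure_gens).1 hd)).trans
      hj'.of_ballGraph).mono (by lia)
  have := joined_of_ball_mul hpow hpow hh hh' (ball_conj_pow hs hhh hr)
  exact ((hj.trans this).trans hj'.symm).mono (by lia)

theorem IsSymmetry.joined {f : Heis 1 ≃* Heis 1} (hf : IsSymmetry f)
    (h : Joined (ballGraph gens n) k g g') : Joined (ballGraph gens n) k (f g) (f g') :=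
  h.map_ballGraph closure_gens closure_gens (f := f.toMonoidHom) f.injective
    fun g => (hf.wordLength_eq g).le

theorem IsSymmetry.wordDist_eq {f : Heis 1 ≃* Heis 1} (hf : IsSymmetry f) (g g' : Heis 1) :
    wordDist gens (f g) (f g') = wordDist gens g g' := by
  simp only [wordDist_eq_wordLength closure_gens, ← map_inv, ← map_mul, hf.wordLength_eq]

theorem Descends.of_symmetry {f : Heis 1 ≃* Heis 1} (hf : IsSymmetry f)
    (h : Descends n L r (f s) (f g)) : Descends n L r s g := by
  obtain ⟨h, hj, hh⟩ := h
  refine ⟨f.symm h, by simpa using hf.symm.joined hj, ?_⟩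
  rwa [← hf.ball_iff, map_mul, map_pow, f.apply_symm_apply]

end Descending

section Room

variable {n k r L : ℕ} {R p q : ℤ} {g g' : Heis 1}

/-- The box along the boundary of which a path of length `n` to `g` runs can be chosen to exceed `g`
by `R` in the first coordinate: there is length enough for it, and such a box is not wider than a
square. -/
def HasRoom (n R : ℤ) (g : Heis 1) : Prop :=
  |g.a| + |g.b| + 2 * R ≤ n ∧ 3 * |g.a| + 4 * R ≤ n + |g.b|

theorem HasRoom.of_le {n R' : ℤ} (h : HasRoom n R g) (hR : R' ≤ R) : HasRoom n R' g :=
  ⟨by linarith [h.1], by linarith [h.2]⟩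

theorem HasRoom.of_dist {n R d : ℤ} (h : HasRoom n (R + d) g)
    (hd : |g'.a - g.a| + |g'.b - g.b| ≤ d) : HasRoom n R g' := by
  have ha := abs_sub_abs_le_abs_sub g'.a g.a
  have hb := abs_abs_sub_abs_le g'.b g.b
  rw [abs_le] at hb
  constructor <;> linarith [h.1, h.2, abs_nonneg (g'.a - g.a)]

theorem Ball.exists_box {n : ℤ} (h : Ball n g) : ∃ p q : ℤ, |g.a| ≤ p ∧ |g.b| ≤ q ∧
    2 * (p + q) ≤ n + |g.a| + |g.b| ∧ n + |g.a| + |g.b| ≤ 2 * (p + q) + 1 ∧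
    |area g| + |g.a| * |g.b| ≤ 2 * p * q := by
  obtain ⟨p, q, hp, hq, hn, hpq⟩ := h
  refine ⟨p, (n + |g.a| + |g.b|) / 2 - p, hp, by lia, by lia, by lia, hpq.trans ?_⟩
  exact mul_le_mul_of_nonneg_left (by lia) (by linarith [abs_nonneg g.a])

theorem Ball.exists_wide_box {n : ℤ} (h : Ball n g) (hroom : HasRoom n R g) :
    ∃ p q : ℤ, |g.a| + R ≤ p ∧ |g.b| ≤ q ∧ 2 * (p + q) ≤ n + |g.a| + |g.b| ∧
      |area g| + |g.a| * |g.b| ≤ 2 * p * q := by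
  obtain ⟨p, q, -, hq, hn, hn', hpq⟩ := h.exists_box
  obtain ⟨h1, h2⟩ := hroom
  rcases le_or_gt (|g.a| + R) p with hp' | hp'
  · exact ⟨p, q, hp', hq, hn, hpq⟩
  · refine ⟨|g.a| + R, p + q - (|g.a| + R), le_rfl, by lia, by lia, hpq.trans ?_⟩
    have : 0 ≤ (|g.a| + R - p) * (q - (|g.a| + R)) := mul_nonneg (by lia) (by lia)
    nlinarith

theorem Ball.exists_narrow_box {n : ℤ} (h : Ball n g) (hR : 0 ≤ R) (hroom : ¬ HasRoom n R g) :
    ∃ p q : ℤ, |g.a| ≤ p ∧ p ≤ |g.a| + R ∧ |g.b| ≤ q ∧ 2 * (p + q) ≤ n + |g.a| + |g.b| ∧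
      n + |g.a| + |g.b| ≤ 2 * (p + q) + 1 ∧ |area g| + |g.a| * |g.b| ≤ 2 * p * q := by
  obtain ⟨p, q, hp, hq, hn, hn', hpq⟩ := h.exists_box
  rcases le_or_gt p (|g.a| + R) with hp' | hp'
  · exact ⟨p, q, hp, hp', hq, hn, hn', hpq⟩
  · have hq' : q ≤ |g.a| + R := by
      by_contra!
      exact hroom ⟨by lia, by lia⟩
    refine ⟨|g.a| + R, p + q - (|g.a| + R), by lia, le_rfl, by lia, by lia, by lia, hpq.trans ?_⟩
    have : 0 ≤ (p - (|g.a| + R)) * (|g.a| + R - q) := mul_nonneg (by lia) (by lia)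
    nlinarith

theorem Ball.mul_x_pow {n : ℤ} (h : Ball n g) (ha : 0 ≤ g.a) (hb : 0 ≤ g.b) (ht : 0 ≤ area g)
    (hroom : HasRoom n r g) : Ball (n - r) (g * x ^ r) := by
  obtain ⟨p, q, hp, hq, hn, hpq⟩ := h.exists_wide_box hroom
  rw [abs_of_nonneg ha] at hp hn hpq
  rw [abs_of_nonneg hb] at hq hn hpq
  rw [abs_of_nonneg ht] at hpq
  have : (g.a + r) * g.b ≤ p * q := mul_le_mul hp hq hb (by lia)
  have : 0 ≤ g.a * g.b := mul_nonneg ha hb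
  refine ball_of_nonneg (p := p) (q := q) ?_ ?_ ?_ ?_ ?_ ?_ ?_ <;> simp <;> linarith

theorem ball_mul_y_inv_pow {n : ℤ} (ha : 0 ≤ g.a) (hq : g.b ≤ q)
    (hn : 2 * (g.a + q) ≤ n + g.a + g.b) (hpq : area g + g.a * g.b ≤ 2 * g.a * q)
    (hpq' : -area g + g.a * g.b ≤ 2 * g.a * (q - r)) (hr : r ≤ q) :
    Ball (n - r) (g * y⁻¹ ^ r) := by
  have ha' : (g * y⁻¹ ^ r).a = g.a := by simp
  have hb' : (g * y⁻¹ ^ r).b = g.b - r := by simp [sub_eq_add_neg]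
  have ht' : area (g * y⁻¹ ^ r) = area g - g.a * r := by simp [sub_eq_add_neg]
  rcases le_or_gt (r : ℤ) g.b with hrb | hrb
  · refine ball_of_nonneg (p := g.a) (q := q - r) ?_ ?_ ?_ ?_ ?_ ?_ ?_ <;>
      simp only [ha', hb', ht'] <;> linarith
  · refine ⟨g.a, q - g.b, ?_⟩
    rw [ha', hb', ht', abs_of_nonneg ha, abs_of_nonpos (by lia : g.b - r ≤ 0)]
    refine ⟨le_rfl, by lia, by lia, ?_⟩
    cases abs_cases (area g - g.a * r) <;> linarith

theorem descends_of_narrow_box (ha : 0 ≤ g.a) (hb : 0 ≤ g.b) (ht : -(2 * area g) ≤ g.a * g.b)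
    (hp : g.a ≤ p) (hpL : p ≤ g.a + L) (hpa : p ≤ 2 * g.a) (hq : g.b ≤ q)
    (hn : 2 * (p + q) ≤ n + g.a + g.b) (hpq : area g + g.a * g.b ≤ 2 * p * q) (hr : 9 * r ≤ q) :
    Descends n L r y⁻¹ g := by
  -- `x ^ j` leads to the far side of the box, down which `y⁻¹ ^ r` descends.
  obtain ⟨j, rfl⟩ : ∃ j : ℕ, p = g.a + j := ⟨(p - g.a).toNat, by lia⟩
  have hab : 0 ≤ g.a * g.b := mul_nonneg ha hb
  have corner : Ball (n - j) (g * x ^ j) := by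
    have : (g.a + j) * g.b ≤ (g.a + j) * q := mul_le_mul_of_nonneg_left hq (by lia)
    refine ball_of_nonneg (p := g.a + j) (q := q) ?_ ?_ ?_ ?_ ?_ ?_ ?_ <;> simp <;> lia
  have hj : wordLength gens (x ^ j) ≤ j := wordLength_pow_le_of_mem closure_gens (.inl x_mem_gens) j
  refine ⟨g * x ^ j, (joined_mul_of_ball hj corner).mono (by lia),
    ball_mul_y_inv_pow (q := q) ?_ ?_ ?_ ?_ ?_ (by lia)⟩ <;> simp <;> try lia
  rcases le_or_gt (g.b + r) q with hbr | hbr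
  · have : 0 ≤ (g.a + j) * (q - r - g.b) := mul_nonneg (by lia) (by lia)
    linarith
  · have : 0 ≤ (g.a + j) * (q - g.b) := mul_nonneg (by lia) (by lia)
    have : 0 ≤ g.a * (g.b - 8 * r) := mul_nonneg ha (by lia)
    have : 0 ≤ (g.a - j) * r := mul_nonneg (by lia) (by lia)
    linarith

theorem Ball.mul_y_pow {n : ℤ} (h : Ball n g) (ha : g.a ≤ 0) (hb : 0 ≤ g.b) (ht : 0 ≤ area g)
    (hroom : HasRoom n r (rot.symm g)) : Ball (n - r) (g * y ^ r) := by
  have := ((isSymmetry_rot.symm.ball_iff n g).2 h).mul_x_pow (r := r) (by simpa) (by simpa)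
    (by simpa) hroom
  rwa [← rot_symm_y, ← map_pow, ← map_mul, isSymmetry_rot.symm.ball_iff] at this

theorem exists_joined_of_second_quadrant (ha : g.a ≤ 0) (hb : 0 ≤ g.b) (ht : 0 ≤ area g)
    (h : Ball n g) (hk : -g.a ≤ k) (hroom : HasRoom n k (rot.symm g)) :
    ∃ h, Joined (ballGraph gens n) (2 * k) g h ∧ Ball n h ∧ h.a = 0 ∧ h.b = g.b + k ∧
      area h = area g + g.a * (g.b + 2 * k) := by
  obtain ⟨j, hj⟩ : ∃ j : ℕ, (j : ℤ) = -g.a := ⟨(-g.a).toNat, by lia⟩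
  have up := h.mul_y_pow ha hb ht hroom
  have hy : wordLength gens (y ^ k) ≤ k := wordLength_pow_le_of_mem closure_gens (.inl y_mem_gens) k
  have hx : wordLength gens (x ^ j) ≤ j := wordLength_pow_le_of_mem closure_gens (.inl x_mem_gens) j
  have hlen := wordLength_add_le_of_ball up
  have hright : Joined (ballGraph gens n) k (g * y ^ k) (g * y ^ k * x ^ j) := by
    refine joined_ballGraph_of_wordDist_le closure_gens ?_ hlen
    rw [wordDist_eq_wordLength closure_gens, inv_mul_cancel_left]
    lia
  refine ⟨g * y ^ k * x ^ j, ((joined_mul_of_ball hy up).trans hright).mono (by lia), ?_, ?_, ?_,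
    ?_⟩
  · have := wordLength_mul_le closure_gens (g * y ^ k) (x ^ j)
    exact ball_of_wordLength_le (by lia)
  · simp [hj]
  · simp
  · simp [hj]
    ring

theorem HasRoom.descends (hroom : HasRoom n R g) (ha : -k ≤ g.a) (hb : 0 ≤ g.b)
    (ht : k * (g.b + 2 * k) ≤ area g) (h : Ball n g) (hR : 9 * r + 4 * k + 1 ≤ R) :
    Descends n (2 * k) r x g := by
  obtain ⟨h1, h2⟩ := hroom
  have ht' : 0 ≤ area g := le_trans (by positivity) ht
  rw [abs_of_nonneg hb] at h1 h2
  rcases le_or_gt 0 g.a with ha' | ha'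
  · refine (Descends.of_ball (h.mul_x_pow ha' hb ht' ⟨?_, ?_⟩)).mono (Nat.zero_le _) <;>
      rw [abs_of_nonneg hb] <;> lia
  rw [abs_of_neg ha'] at h1 h2
  -- With `g` left of the `b`-axis, go up and then right to the axis if there is room above `g`;
  -- otherwise the box of `g` ends just above it, and turning right there descends.
  by_cases hroom' : HasRoom n k (rot.symm g)
  · obtain ⟨g', hj, hg', ha₀, hb₀, ht₀⟩ :=
      exists_joined_of_second_quadrant ha'.le hb ht' h (by lia) hroom'
    refine (Descends.of_joined hj (Descends.of_ball (hg'.mul_x_pow ha₀.ge (by lia) ?_ ?_))).mono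
      le_rfl
    · rw [ht₀]
      nlinarith
    · rw [HasRoom, ha₀, hb₀, abs_zero, abs_of_nonneg (by lia)]
      lia
  · obtain ⟨p, q, hp, hpk, hq, hn, hn', hpq⟩ :=
      ((isSymmetry_rot.symm.ball_iff n g).2 h).exists_narrow_box k.cast_nonneg hroom'
    rw [HasRoom] at hroom'
    simp only [rot_symm_a, rot_symm_b, area_rot_symm, abs_neg, abs_of_nonneg hb, abs_of_neg ha',
      abs_of_nonneg ht'] at *
    refine Descends.of_symmetry isSymmetry_rot.symm (Descends.mono ?_ (by lia : k ≤ 2 * k))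
    have : 0 ≤ g.b * -g.a := mul_nonneg hb (by lia)
    rw [rot_symm_x]
    refine descends_of_narrow_box (p := p) (q := q) ?_ ?_ ?_ ?_ ?_ ?_ ?_ ?_ ?_ (by lia) <;>
      simp only [rot_symm_a, rot_symm_b, area_rot_symm] <;> lia

end Room

section Near

variable {n m : ℕ} {M : ℤ} {g g' : Heis 1}

theorem abs_sub_add_abs_sub_le (hd : wordDist gens g g' ≤ m) :
    |g'.a - g.a| + |g'.b - g.b| ≤ m := by
  rw [wordDist_eq_wordLength closure_gens] at hd
  simpa [neg_add_eq_sub] using (ball_of_wordLength_le hd).abs_add_abs_le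

theorem abs_area_sub_area_le (hd : wordDist gens g g' ≤ m) :
    |area g' - area g| ≤ m * (|g.a| + |g.b|) + m ^ 2 := by
  obtain ⟨u, rfl⟩ : ∃ u, g' = g * u := ⟨g⁻¹ * g', by group⟩
  rw [wordDist_eq_wordLength closure_gens, inv_mul_cancel_left] at hd
  have hu := ball_of_wordLength_le hd
  have hab := hu.abs_add_abs_le
  have hcross : |g.a * u.b - u.a * g.b| ≤ m * (|g.a| + |g.b|) := by
    refine (abs_sub _ _).trans ?_
    rw [abs_mul, abs_mul]
    nlinarith [abs_nonneg g.a, abs_nonneg g.b, abs_nonneg u.a, abs_nonneg u.b]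
  rw [area_mul, show area g + area u + (g.a * u.b - u.a * g.b) - area g =
    (g.a * u.b - u.a * g.b) + area u by ring]
  exact (abs_add_le _ _).trans (add_le_add hcross hu.abs_area_le)

theorem lt_area_of_not_ball {n : ℤ} (ha : 0 ≤ g.a) (hb : 0 ≤ g.b) (ht : 0 ≤ area g)
    (h : ¬ Ball (n - 1) g) (hM : 0 ≤ M) (hn : g.a + g.b + 4 * M + 1 ≤ n) :
    M * (g.a + g.b) + M ^ 2 < area g := by
  by_contra! hle
  have : 0 ≤ g.a * g.b := mul_nonneg ha hb
  have : 0 ≤ M * (g.a + g.b) := mul_nonneg hM (by lia)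
  refine h (ball_of_nonneg (p := g.a + M) (q := g.b + M) ha hb ?_ ?_ ?_ ?_ ?_) <;> nlinarith

end Near

section Cases

variable {n m D : ℕ} {g g' : Heis 1}

theorem HasRoom.descends_of_third_quadrant (hroom : HasRoom n (599 * m) g) (hm : 1 ≤ m)
    (ha : -m ≤ g.a) (ha' : g.a ≤ 0) (hb : -m ≤ g.b) (hb' : g.b ≤ 0) (ht : 15 * m ^ 2 ≤ area g)
    (h : Ball n g) : Descends n (6 * m) (65 * m) x g := by
  have hn := hroom.2
  have hroom' : HasRoom n m (rot.symm (rot.symm g)) := by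
    have h₁ := hroom.1
    constructor <;> simp only [rot_symm_a, rot_symm_b, abs_neg] <;> lia
  obtain ⟨g', hj, hg', ha₁, hb₁, ht₁⟩ := exists_joined_of_second_quadrant (g := rot.symm g)
    (n := n) (k := m) hb' (by simpa) (by simp; lia) ((isSymmetry_rot.symm.ball_iff n g).2 h)
    (by simp; lia) hroom'
  simp only [rot_symm_a, rot_symm_b, area_rot_symm] at hb₁ ht₁
  have hj : Joined (ballGraph gens n) (2 * m) g (rot g') := by simpa using isSymmetry_rot.joined hj
  have hroom'' : HasRoom n (593 * m + 1) (rot g') := by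
    rw [abs_of_nonpos ha', abs_of_nonpos hb'] at hn
    constructor <;> rw [rot_a, rot_b, ha₁, hb₁, abs_zero, abs_of_nonpos (by lia)] <;> lia
  refine (Descends.of_joined hj (hroom''.descends (k := 2 * m) ?_ ?_ ?_
    ((isSymmetry_rot.ball_iff n g').2 hg') ?_)).mono (by lia)
  · simp; lia
  · simp [ha₁]
  · have : 0 ≤ (-g.b) * (g.a + m) := mul_nonneg (by lia) (by lia)
    simp [ha₁, ht₁]
    nlinarith
  · push_cast
    lia

theorem HasRoom.descends_x_of_near (hroom : HasRoom n (599 * m) g) (hm : 1 ≤ m) (ha : -m ≤ g.a)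
    (hb : 0 ≤ g.b) (ht : m * (g.b + 2 * m) ≤ area g) (h : Ball n g) :
    Descends n (6 * m) (65 * m) x g :=
  (hroom.descends (r := 65 * m) ha hb ht h (by lia)).mono (by lia)

theorem HasRoom.descends_y_inv_of_near (hroom : HasRoom n (599 * m) g) (hm : 1 ≤ m) (ha : 0 ≤ g.a)
    (hb : |g.b| ≤ m) (ht : m * (g.a + 2 * m) ≤ area g) (h : Ball n g) :
    Descends n (6 * m) (65 * m) y⁻¹ g := by
  obtain ⟨h₁, h₂⟩ := hroom
  have hroom' : HasRoom n (590 * m) (rot g) := by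
    rw [abs_of_nonneg ha] at h₁ h₂
    constructor <;> rw [rot_a, rot_b, abs_neg, abs_of_nonneg ha] <;> lia
  rw [abs_le] at hb
  refine Descends.of_symmetry isSymmetry_rot ((hroom'.descends (k := m) (r := 65 * m) ?_ ?_ ?_
    ((isSymmetry_rot.ball_iff n g).2 h) ?_).mono (by lia)) <;> simp <;> lia

-- As `6 m` is the longest detour, `65 m = 5 (2 (6 m) + m)` steps in a common direction are needed,
-- and `HasRoom.descends` asks for room of `9 (65 m)` and a little more.
theorem joined_of_hasRoom (hm : 1 ≤ m) (ha : 0 ≤ g.a) (hb : 0 ≤ g.b) (ht : 0 ≤ area g)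
    (h : Ball n g) (hlen : ¬ Ball (n - 1) g) (h' : Ball n g') (hd : wordDist gens g g' ≤ m)
    (hroom : HasRoom n (600 * m) g) : Joined (ballGraph gens n) (272 * m) g g' := by
  have hab := abs_sub_add_abs_sub_le hd
  have ht' := abs_area_sub_area_le hd
  have hroom₀ : HasRoom n (599 * m) g := hroom.of_le (by lia)
  have hroom' : HasRoom n (599 * m) g' := HasRoom.of_dist (d := m) (hroom.of_le (by lia)) hab
  obtain ⟨h₁, h₂⟩ := hroom
  rw [abs_of_nonneg ha, abs_of_nonneg hb] at h₁ h₂ ht'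
  have ht₀ := lt_area_of_not_ball (M := 4 * m) ha hb ht hlen (by lia) (by lia)
  have hm₂ : (0 : ℤ) ≤ m ^ 2 := sq_nonneg _
  have hma : (0 : ℤ) ≤ m * g.a := mul_nonneg (by lia) ha
  have hmb : (0 : ℤ) ≤ m * g.b := mul_nonneg (by lia) hb
  have ht₁ : m * (3 * (g.a + g.b)) + 15 * m ^ 2 ≤ area g' := by linarith [abs_le.1 ht']
  have ha' : |g'.a - g.a| ≤ m := by linarith [abs_nonneg (g'.b - g.b)]
  have hb' : |g'.b - g.b| ≤ m := by linarith [abs_nonneg (g'.a - g.a)]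
  rw [abs_le] at ha' hb'
  have hmb' : (m : ℤ) * g'.b ≤ m * (g.b + m) := mul_le_mul_of_nonneg_left (by lia) (by lia)
  have hma' : (m : ℤ) * g'.a ≤ m * (g.a + m) := mul_le_mul_of_nonneg_left (by lia) (by lia)
  obtain ⟨s, hs, hg, hg'⟩ : ∃ s ∈ gens ∪ gens⁻¹,
      Descends n (6 * m) (65 * m) s g ∧ Descends n (6 * m) (65 * m) s g' := by
    rcases le_or_gt 0 g'.b with hb₀ | hb₀
    · exact ⟨x, .inl x_mem_gens, hroom₀.descends_x_of_near hm (by lia) hb (by linarith) h,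
        hroom'.descends_x_of_near hm (by lia) hb₀ (by linarith) h'⟩
    rcases le_or_gt 0 g'.a with ha₀ | ha₀
    · exact ⟨y⁻¹, .inr (by simp [y_mem_gens]),
        hroom₀.descends_y_inv_of_near hm ha (by rw [abs_le]; lia) (by linarith) h,
        hroom'.descends_y_inv_of_near hm ha₀ (by rw [abs_le]; lia) (by linarith) h'⟩
    · exact ⟨x, .inl x_mem_gens, hroom₀.descends_x_of_near hm (by lia) hb (by linarith) h,
        hroom'.descends_of_third_quadrant hm (by lia) ha₀.le (by lia) hb₀.le (by linarith) h'⟩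
  exact (hg.joined hs (by lia) hd hg').mono (by lia)

theorem descends_of_near_narrow (hm : 1 ≤ m) (ha : 53000 * m ≤ g.a) (hb : -m ≤ g.b)
    (hna : g.a + 109999 * m ≤ n) (ht : 0 ≤ g.b → -(2 * area g) ≤ g.a * g.b)
    (ht' : g.b < 0 → 0 ≤ area g) (h : Ball n g) (hroom : ¬ HasRoom n (601 * m) g) :
    Descends n (601 * m) (6015 * m) y⁻¹ g := by
  rcases le_or_gt 0 g.b with hb₀ | hb₀
  · obtain ⟨p, q, hp, hpR, hq, hn, hn', hpq⟩ := h.exists_narrow_box (by lia) hroom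
    rw [abs_of_nonneg hb₀] at hq hn hn' hpq
    rw [abs_of_nonneg (by lia : 0 ≤ g.a)] at hp hpR hn hn' hpq
    exact descends_of_narrow_box (p := p) (q := q) (by lia) hb₀ (ht hb₀) hp (by lia) (by lia) hq hn
      (by linarith [le_abs_self (area g)]) (by lia)
  · have hroom' : HasRoom n (6015 * m : ℕ) (rot g) := by
      constructor <;> rw [rot_a, rot_b, abs_neg, abs_of_neg hb₀,
        abs_of_nonneg (by lia : 0 ≤ g.a)] <;> lia
    have := ((isSymmetry_rot.ball_iff n g).2 h).mul_x_pow (by simpa using hb₀.le) (by simp; lia)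
      (by simpa using ht' hb₀) hroom'
    rw [← rot_y_inv] at this
    exact ((Descends.of_ball this).of_symmetry isSymmetry_rot).mono (Nat.zero_le _)

-- As `601 m` is the detour to the corner, `6015 m = 5 (2 (601 m) + m)` steps down are needed.
theorem joined_of_not_hasRoom (hm : 1 ≤ m) (ha : 0 ≤ g.a) (hb : 0 ≤ g.b) (ht : 0 ≤ area g)
    (h : Ball n g) (hlen : ¬ Ball (n - 1) g) (h' : Ball n g') (hd : wordDist gens g g' ≤ m)
    (hroom : ¬ HasRoom n (600 * m) g) (hna : g.a + 110000 * m ≤ n) (hnb : g.b + 110000 * m ≤ n) :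
    Joined (ballGraph gens n) (25262 * m) g g' := by
  have ha₀ : 53800 * m ≤ g.a := by
    by_contra!
    refine hroom ⟨?_, ?_⟩ <;> rw [abs_of_nonneg ha, abs_of_nonneg hb] <;> lia
  have hab := abs_sub_add_abs_sub_le hd
  have ht' := abs_area_sub_area_le hd
  have hg : Descends n (601 * m) (6015 * m) y⁻¹ g :=
    descends_of_near_narrow hm (by lia) (by lia) (by lia)
      (fun _ => by linarith [mul_nonneg ha hb]) (fun _ => ht) h
      (mt (HasRoom.of_le · (by lia)) hroom)
  have hroom' : ¬ HasRoom n (601 * m) g' := fun hr =>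
    hroom (HasRoom.of_dist (d := m) (hr.of_le (by lia)) (by simpa only [abs_sub_comm] using hab))
  have ha' : |g'.a - g.a| ≤ m := by linarith [abs_nonneg (g'.b - g.b)]
  have hb' : |g'.b - g.b| ≤ m := by linarith [abs_nonneg (g'.a - g.a)]
  rw [abs_of_nonneg ha, abs_of_nonneg hb] at ht'
  rw [abs_le] at ha' hb' ht'
  have harea (hb₀ : g.b < 10 * m) : 0 ≤ area g' := by
    linarith [lt_area_of_not_ball (M := m) ha hb ht hlen (by lia) (by lia)]
  have hg' : Descends n (601 * m) (6015 * m) y⁻¹ g' := by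
    refine descends_of_near_narrow hm (by lia) (by lia) (by lia) (fun hb₁ => ?_)
      (fun hb₁ => harea (by lia)) h' hroom'
    rcases lt_or_ge g.b (10 * m) with hb₀ | hb₀
    · linarith [harea hb₀, mul_nonneg (by lia : 0 ≤ g'.a) hb₁]
    · have : (g.a - m) * (g.b - m) ≤ g'.a * g'.b := mul_le_mul (by lia) (by lia) (by lia) (by lia)
      have : g.a * (10 * m) ≤ g.a * g.b := mul_le_mul_of_nonneg_left hb₀ ha
      have : 53800 * m * g.b ≤ g.a * g.b := mul_le_mul_of_nonneg_right ha₀ hb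
      have : m * (53800 * m) ≤ m * g.a := mul_le_mul_of_nonneg_left ha₀ (by lia)
      have : (0 : ℤ) ≤ m ^ 2 := sq_nonneg _
      linarith
  exact (hg.joined (.inr (by simp [y_mem_gens])) (by lia) hd hg').mono (by lia)

theorem exists_mul_ball {r : ℕ} (hr : r ≤ n) (h : Ball n g) :
    ∃ u, wordLength gens u ≤ r ∧ Ball (n - r) (g * u) := by
  obtain ⟨k, rfl⟩ := Nat.exists_eq_add_of_le hr
  have hd : wordDist gens g 1 ≤ r + k := by
    rw [wordDist_comm]
    exact wordLength_le_of_ball h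
  obtain ⟨w, hgw, hw⟩ := ((wordDist_le_iff closure_gens).1 hd).exists_add
  refine ⟨g⁻¹ * w, ?_, ?_⟩
  · rw [← wordDist_eq_wordLength closure_gens, wordDist_le_iff closure_gens]
    exact hgw
  · have : wordLength gens w ≤ k := (wordDist_le_iff closure_gens).2 hw.symm
    rw [mul_inv_cancel_left]
    simpa using ball_of_wordLength_le this

-- `g.a` within `D` of `n` forces the first `r` steps `u` of a shortest path from `g` to `1` to
-- follow `x⁻¹ ^ r` up to `D`.
theorem abs_le_of_ball_mul {r : ℕ} {u : Heis 1} (hn : n ≤ g.a + D) (hu : wordLength gens u ≤ r)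
    (h : Ball (n - r) (g * u)) : |u.a + r| ≤ D ∧ |u.b| ≤ D ∧ |area u| ≤ 2 * r * D := by
  have hab := h.abs_add_abs_le
  have hu := ball_of_wordLength_le hu
  have hab' := hu.abs_add_abs_le
  have ha₀ := neg_le_abs u.a
  have hb₀ := abs_nonneg u.b
  simp only [mul_a, mul_b] at hab
  have hua : g.a + u.a ≤ n - r := by linarith [le_abs_self (g.a + u.a), abs_nonneg (g.b + u.b)]
  have hua' : -u.a ≤ r := by linarith
  obtain ⟨p, q, hp, hq, hpq, hpq'⟩ := hu
  refine ⟨abs_le.2 ⟨by lia, by lia⟩, by linarith, ?_⟩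
  have : p * q ≤ r * D := mul_le_mul (by lia) (by lia) (by lia) (by lia)
  have : 0 ≤ |u.a| * |u.b| := by positivity
  linarith

theorem ball_inv_mul_mul {r : ℕ} {u u' w : Heis 1} (hr : 20 * D ≤ r)
    (hu : |u.a + r| ≤ D ∧ |u.b| ≤ D ∧ |area u| ≤ 2 * r * D)
    (hu' : |u'.a + r| ≤ D ∧ |u'.b| ≤ D ∧ |area u'| ≤ 2 * r * D) (hw : wordLength gens w ≤ D) :
    Ball (2 * r) (u⁻¹ * w * u') := by
  have hw := ball_of_wordLength_le hw
  obtain ⟨ha, hb, ht⟩ := hu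
  obtain ⟨ha', hb', ht'⟩ := hu'
  have hwa : |w.a| ≤ D := by linarith [hw.abs_add_abs_le, abs_nonneg w.b]
  have hwb : |w.b| ≤ D := by linarith [hw.abs_add_abs_le, abs_nonneg w.a]
  have hwt := hw.abs_area_le
  have prod {i j : ℤ} (hi : |i| ≤ D) (hj : |j| ≤ D) : |i * j| ≤ D * D := by
    rw [abs_mul]
    exact mul_le_mul hi hj (abs_nonneg j) (by positivity)
  have h₁ := prod ha hwb
  have h₂ := prod ha hb'
  have h₃ := prod ha' hb
  have h₄ := prod ha' hwb
  have h₅ := prod hwa hb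
  have h₆ := prod hwa hb'
  have hrb (i : ℤ) (hi : |i| ≤ D) : |r * i| ≤ r * D := by
    rw [abs_mul, abs_of_nonneg r.cast_nonneg]
    exact mul_le_mul_of_nonneg_left hi r.cast_nonneg
  have h₇ := hrb _ hwb
  have h₈ := hrb _ hb
  have h₉ := hrb _ hb'
  have hD : (0 : ℤ) ≤ D ^ 2 := sq_nonneg _
  simp only [abs_le] at *
  refine ball_two_mul_of_abs_le (D := 4 * D) ?_ ?_ ?_ (by lia) <;> rw [abs_le] <;> simp <;>
    constructor <;> linarith

theorem joined_of_thin (h : Ball n g) (h' : Ball n g') (hd : wordDist gens g g' ≤ m)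
    (hna : n + m ≤ g.a + D) (hmD : m ≤ D) : Joined (ballGraph gens n) (80 * D) g g' := by
  rcases le_or_gt (20 * D) n with hn | hn
  · obtain ⟨u, hu, hgu⟩ := exists_mul_ball hn h
    obtain ⟨u', hu', hgu'⟩ := exists_mul_ball hn h'
    have ha' : |g'.a - g.a| ≤ m := by
      linarith [abs_sub_add_abs_sub_le hd, abs_nonneg (g'.b - g.b)]
    rw [abs_le] at ha'
    refine (joined_of_ball_mul hu hu' hgu hgu' (ball_inv_mul_mul (D := D) le_rfl
      (abs_le_of_ball_mul (by lia) hu hgu) (abs_le_of_ball_mul (by lia) hu' hgu') ?_)).mono (by lia)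
    rw [← wordDist_eq_wordLength closure_gens]
    exact hd.trans hmD
  · exact (joined_ballGraph_via_one closure_gens (wordLength_le_of_ball h)
      (wordLength_le_of_ball h')).mono (by lia)

theorem joined_of_quadrant (hm : 1 ≤ m) (ha : 0 ≤ g.a) (hb : 0 ≤ g.b) (ht : 0 ≤ area g)
    (h : Ball n g) (hlen : ¬ Ball (n - 1) g) (h' : Ball n g') (hd : wordDist gens g g' ≤ m) :
    Joined (ballGraph gens n) (80 * (110001 * m)) g g' := by
  rcases le_or_gt (g.a + 110000 * m) n with hna | hna
  swap
  · exact joined_of_thin h h' hd (by lia) (by lia)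
  rcases le_or_gt (g.b + 110000 * m) n with hnb | hnb
  swap
  · have hs := isSymmetry_swap
    have := joined_of_thin (D := 110001 * m) ((hs.ball_iff n g).2 h) ((hs.ball_iff n g').2 h')
      ((hs.wordDist_eq g g').trans_le hd) (by simp; lia) (by lia)
    simpa using hs.symm.joined this
  by_cases hroom : HasRoom n (600 * m) g
  · exact (joined_of_hasRoom hm ha hb ht h hlen h' hd hroom).mono (by lia)
  · exact (joined_of_not_hasRoom hm ha hb ht h hlen h' hd hroom hna hnb).mono (by lia)

theorem joined_of_wordLength_le (hm : 1 ≤ m) (hd : wordDist gens g g' ≤ m)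
    (hlen : wordLength gens g' ≤ wordLength gens g) :
    Joined (ballGraph gens (wordLength gens g)) (80 * (110001 * m)) g g' := by
  obtain ⟨f, hf, ha, hb, ht⟩ := exists_symmetry g
  have hg : ¬ Ball (wordLength gens g - 1) g := by
    rw [← wordLength_le_iff_ball]
    lia
  have := joined_of_quadrant hm ha hb ht ((hf.ball_iff _ g).2 (ball_of_wordLength_le le_rfl))
    (mt (hf.ball_iff _ g).1 hg) ((hf.ball_iff _ g').2 (ball_of_wordLength_le hlen))
    ((hf.wordDist_eq g g').trans_le hd)
  simpa using hf.symm.joined this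

end Cases

theorem ballConvex_gens : BallConvex gens := fun m => by
  refine ⟨80 * (110001 * (m + 1)), fun n g g' hg hg' hd => ?_⟩
  have hd : wordDist gens g g' ≤ m + 1 := hd.trans m.le_succ
  rcases le_total (wordLength gens g') (wordLength gens g) with hlen | hlen
  · exact (joined_of_wordLength_le (by lia) hd hlen).ballGraph_mono hg
  · rw [wordDist_comm] at hd
    exact ((joined_of_wordLength_le (by lia) hd hlen).ballGraph_mono hg').symm

/-! ### Almost convexity of `Heis e` -/

section Distortion

variable {e n L : ℕ} {g : Heis e} {u : Heis 1}

/-- The embedding of `Heis 1` into `Heis e` as the subgroup generated by `x` and `y`. -/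
def incl (e : ℕ) : Heis 1 →* Heis e :=
  MonoidHom.mk' (fun g => ⟨g.a, g.b, e * g.c⟩) fun g h => by
    ext <;> simp
    ring

theorem incl_x : incl e x = x := by ext <;> simp [incl, x]

theorem incl_y : incl e y = y := by ext <;> simp [incl, y]

theorem incl_z_zpow (k : ℤ) : incl e (z ^ k) = z ^ (e * k) := by simp [incl, z_zpow]

theorem incl_injective (he : 1 ≤ e) : Function.Injective (incl e) := by
  intro g h hgh
  rw [Heis.ext_iff] at hgh ⊢
  exact hgh.imp_right (And.imp_right (mul_left_cancel₀ (by lia)))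

theorem wordLength_incl_le (u : Heis 1) : wordLength {x, y, z} (incl e u) ≤ wordLength gens u := by
  refine wordLength_map_le closure_gens closure_x_y_z (incl e) ?_ u
  rintro s (rfl | rfl) <;> simp [incl_x, incl_y]

theorem exists_incl_or_zpow_of_mem {s : Heis e}
    (hs : s ∈ ({x, y, z} : Set (Heis e)) ∪ ({x, y, z} : Set (Heis e))⁻¹) :
    (∃ s' ∈ gens ∪ gens⁻¹, incl e s' = s) ∨ ∃ i : ℤ, i.natAbs = 1 ∧ s = z ^ i := by
  have mem {s : Heis e} (hs : s ∈ ({x, y, z} : Set (Heis e))) :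
      (∃ s' ∈ gens, incl e s' = s) ∨ s = z := by
    obtain rfl | rfl | rfl := hs
    · exact .inl ⟨x, x_mem_gens, incl_x⟩
    · exact .inl ⟨y, y_mem_gens, incl_y⟩
    · exact .inr rfl
  obtain hs | hs := hs
  · obtain ⟨s', hs', h⟩ | h := mem hs
    · exact .inl ⟨s', .inl hs', h⟩
    · exact .inr ⟨1, rfl, by simpa using h⟩
  · obtain ⟨s', hs', h⟩ | h := mem hs
    · exact .inl ⟨s'⁻¹, .inr (by simpa using hs'), by rw [map_inv, h, inv_inv]⟩
    · exact .inr ⟨-1, rfl, by rw [zpow_neg_one, ← h, inv_inv]⟩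

theorem exists_incl_mul_zpow (hg : wordLength {x, y, z} g ≤ n) :
    ∃ (h : Heis 1) (k : ℤ), g = incl e h * z ^ k ∧ wordLength gens h + k.natAbs ≤ n := by
  refine wordLength_induction closure_x_y_z (P := fun n g => ∃ (h : Heis 1) (k : ℤ),
    g = incl e h * z ^ k ∧ wordLength gens h + k.natAbs ≤ n) ?_ ?_ hg
  · exact fun n => ⟨1, 0, by simp, by simp [wordLength_one]⟩
  · rintro n _ s hs ⟨h, k, rfl, hn⟩
    obtain ⟨s', hs', rfl⟩ | ⟨i, hi, rfl⟩ := exists_incl_or_zpow_of_mem hs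
    · have := wordLength_mul_le closure_gens h s'
      have := wordLength_le_one closure_gens hs'
      refine ⟨h * s', k, ?_, by lia⟩
      rw [map_mul, mul_assoc, mul_assoc, ((commute_z (incl e s')).zpow_left k).eq]
    · exact ⟨h, k + i, by rw [mul_assoc, ← zpow_add], by lia⟩

theorem wordLength_z_pow_sq_le (k : ℕ) : wordLength gens (z ^ (k ^ 2)) ≤ 4 * k := by
  have hz : (z : Heis 1) ^ (k ^ 2) = ⟨0, 0, k ^ 2⟩ := by
    rw [← zpow_natCast, z_zpow]
    simp
  refine wordLength_le_of_ball ⟨k, k, ?_⟩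
  simp [hz, area]
  constructor <;> linarith

-- A block `z ^ (25 * e)` is spelled more cheaply in `x` and `y`: `20 < 25 * e`.
theorem exists_incl_mul_zpow_le (he : 1 ≤ e) (hg : wordLength {x, y, z} g ≤ n) :
    ∃ (h : Heis 1) (k : ℤ), g = incl e h * z ^ k ∧ wordLength gens h + k.natAbs ≤ n ∧
      k.natAbs ≤ 25 * e := by
  obtain ⟨h, k, rfl, hn⟩ := exists_incl_mul_zpow hg
  obtain ⟨i, j, rfl, hij, hi⟩ : ∃ i j : ℤ, k = 25 * e * j + i ∧
      20 * j.natAbs + i.natAbs ≤ k.natAbs ∧ i.natAbs ≤ 25 * e := by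
    have hj : (k.tdiv (25 * e)).natAbs = k.natAbs / (25 * e) := by
      rw [Int.natAbs_tdiv]
      simp only [Int.natAbs_mul, Int.natAbs_natCast, Int.reduceAbs]
      rfl
    have hi : (k.tmod (25 * e)).natAbs = k.natAbs % (25 * e) := by
      simp [Int.natAbs_tmod, Int.natAbs_mul]
    have hle : 20 * (k.natAbs / (25 * e)) ≤ 25 * e * (k.natAbs / (25 * e)) := by gcongr; lia
    refine ⟨k.tmod (25 * e), k.tdiv (25 * e), (Int.mul_tdiv_add_tmod k _).symm, ?_, ?_⟩
    · rw [hi, hj]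
      linarith [Nat.div_add_mod k.natAbs (25 * e)]
    · rw [hi]
      exact (Nat.mod_lt k.natAbs (by lia)).le
  refine ⟨h * (z ^ 5 ^ 2) ^ j, i, ?_, ?_, hi⟩
  · rw [map_mul, ← zpow_natCast, ← zpow_mul, incl_z_zpow, mul_assoc (incl e h),
      ← zpow_add]
    congr 2
    push_cast
    ring
  · have := wordLength_mul_le closure_gens h ((z ^ 5 ^ 2) ^ j)
    have := wordLength_zpow_le closure_gens (z ^ 5 ^ 2) j
    have := Nat.mul_le_mul_left j.natAbs (wordLength_z_pow_sq_le 5)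
    lia

theorem wordLength_le_of_incl (he : 1 ≤ e) (hu : wordLength {x, y, z} (incl e u) ≤ L) :
    wordLength gens u ≤ 4 * L := by
  obtain ⟨h, k, hk, hL⟩ := exists_incl_mul_zpow hu
  have hv : incl e (h⁻¹ * u) = z ^ k := by rw [map_mul, map_inv, hk, inv_mul_cancel_left]
  rw [z_zpow, Heis.ext_iff] at hv
  obtain ⟨ha, hb, hc⟩ := hv
  have hz : h⁻¹ * u = z ^ (h⁻¹ * u).c := by
    rw [z_zpow]
    ext
    exacts [ha, hb, rfl]
  have hck : (h⁻¹ * u).c.natAbs ≤ k.natAbs := by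
    have hc : (e : ℤ) * (h⁻¹ * u).c = k := hc
    rw [← hc, Int.natAbs_mul, Int.natAbs_natCast]
    exact Nat.le_mul_of_pos_left _ he
  have h₁ := wordLength_mul_le closure_gens h (h⁻¹ * u)
  have h₂ := wordLength_zpow_le closure_gens z (h⁻¹ * u).c
  have h₃ : wordLength gens z ≤ 4 := by simpa using wordLength_z_pow_sq_le 1
  rw [← hz] at h₂
  rw [mul_inv_cancel_left] at h₁
  have := Nat.mul_le_mul_left (h⁻¹ * u).c.natAbs h₃
  lia

theorem joined_incl_mul_zpow {h : Heis 1} {k : ℤ} (hn : wordLength gens h + k.natAbs ≤ n) :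
    Joined (ballGraph {x, y, z} n) k.natAbs (incl e h) (incl e h * z ^ k) := by
  refine joined_ballGraph_of_wordDist_le closure_x_y_z ?_
    ((Nat.add_le_add_right (wordLength_incl_le h) _).trans hn)
  have hz : wordLength {x, y, z} (z : Heis e) ≤ 1 := wordLength_le_one closure_x_y_z (by simp)
  rw [wordDist_eq_wordLength closure_x_y_z, inv_mul_cancel_left]
  exact (wordLength_zpow_le closure_x_y_z z k).trans
    (by simpa using Nat.mul_le_mul_left k.natAbs hz)

end Distortion

theorem ballConvex_x_y_z {e : ℕ} (he : 1 ≤ e) : BallConvex {x, y, (z : Heis e)} := by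
  intro m
  obtain ⟨K, hK⟩ := ballConvex_gens (4 * (25 * e + m + 25 * e))
  refine ⟨25 * e + K + 25 * e, fun n g g' hg hg' hd => ?_⟩
  obtain ⟨h, k, rfl, hn, hk⟩ := exists_incl_mul_zpow_le he hg
  obtain ⟨h', k', rfl, hn', hk'⟩ := exists_incl_mul_zpow_le he hg'
  have toG := (joined_incl_mul_zpow (e := e) hn).mono hk
  have toG' := (joined_incl_mul_zpow (e := e) hn').mono hk'
  have hd' : wordDist gens h h' ≤ 4 * (25 * e + m + 25 * e) := by
    rw [wordDist_eq_wordLength closure_gens]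
    refine wordLength_le_of_incl he ?_
    rw [map_mul, map_inv, ← wordDist_eq_wordLength closure_x_y_z, wordDist_le_iff closure_x_y_z]
    exact (toG.of_ballGraph.trans ((wordDist_le_iff closure_x_y_z).1 hd)).trans
      toG'.of_ballGraph.symm
  have inside := (hK n h h' (by lia) (by lia) hd').map_ballGraph closure_gens closure_x_y_z
    (incl_injective he) wordLength_incl_le
  exact (toG.symm.trans inside).trans toG'

end Heis

theorem almostConvex_gensN : AlmostConvex gensN where
  finite := by simp [gensN]
  generates := closure_gensN
  almostConvexAt := (ballConvex_gensN Heis.ballConvex_gens).almostConvexAt closure_gensN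

theorem almostConvex_gensNe {e : ℕ} (he : 1 ≤ e) : AlmostConvex (gensNe e) where
  finite := by simp [gensNe]
  generates := closure_gensNe e
  almostConvexAt :=
    (ballConvex_gensNe e (Heis.ballConvex_x_y_z he)).almostConvexAt (closure_gensNe e)

end Nil

theorem theorem3 :
    Nil.AlmostConvex Nil.gensN ∧
      ∀ e : ℕ, 1 ≤ e → Nil.AlmostConvex (Nil.gensNe e) :=
  ⟨Nil.almostConvex_gensN, fun _ he => Nil.almostConvex_gensNe he⟩
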